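/- **Setting.** Fix a first-order language $\mathscr L$: a collection $\mathscr L_q$ of quantifier symbols and, for each $n\in\omega$, a collection $\mathscr L_n$ of $n$-ary propositional connectives, with designated connectives $e\in\mathscr L_0$ and $\otimes\in\mathscr L_2$. For a many-sorted signature $Sg$ (sorts, typed function symbols, typed relation symbols), a context is a finite list $\Gamma=[x_1:\sigma_1,\dots,x_n:\sigma_n]$ of distinct sorted variables; terms $M:\tau\,[\Gamma]$ are built from variables and function symbols, formulas $\varphi\,[\Gamma]$ from $R(M_1,\dots,M_n)$ and $M_1=_\sigma M_2$ by connectives $\Diamond(\varphi_1,\dots,\varphi_n)$ and quantifiers $\Omega_{x:\sigma}(\varphi)\,[\Gamma]$ for $\varphi\,[\Gamma,x:\sigma]$. Expressions are taken up to renaming of bound and free variables. Assertions are equations-in-context $M=M':\tau\,[\Gamma]$ and sequents-in-context $\varphi_1,\dots,\varphi_n\vdash\psi\,[\Gamma]$ ($n\ge 0$). An $Sg$-theory is a set of $Sg$-assertions. A logic $\mathcal L$ is, for each signature, a closure operator $T\mapsto T_{\mathcal L}$ on its theories, all of whose closed theories are closed under equational logic: reflexivity, symmetry, transitivity of equations,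 and $$\frac{M=M':\sigma\,[\Delta]\qquad N=N':\tau\,[\Gamma,x:\sigma,\Gamma']}{N[M/x]=N'[M'/x]:\tau\,[\Gamma,\Gamma']}$$ if all variables of $\Delta$ occur, with their sorts, in $\Gamma,\Gamma'$. An $\mathcal L$-theory is a theory with $T_{\mathcal L}=T$; and $\mathcal L\supseteq\mathcal L'$ means $T_{\mathcal L'}\subseteq T_{\mathcal L}$ for all $T$. The minimal logic $\mathcal L^m$ is given by the rules of equational logic and the following rules ($\varphi\dashv\vdash\psi$ stands for the two sequents $\varphi\vdash\psi$ and $\psi\vdash\varphi$). * Ax: $\varphi\vdash\varphi\,[\Gamma]$. Cut: from $\varphi\vdash\psi\,[\Gamma]$ and $\psi\vdash\theta\,[\Gamma]$ infer $\varphi\vdash\theta\,[\Gamma]$. * Cwk: from $\Phi\vdash\psi\,[\Gamma]$ infer $\Phi\vdash\psi\,[\Gamma,x:\sigma]$. * Sub: from $M=M':\sigma\,[\Delta]$ and $\Phi\vdash\psi\,[\Gamma,x:\sigma,\Gamma']$ infer $\Phi[M/x]\vdash\psi[M'/x]\,[\Gamma,\Gamma']$, with $\Delta$ as above. * For each $\Omega\in\mathscr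 L_q$: from $\varphi\dashv\vdash\psi\,[\Gamma,x:\sigma]$ infer $\Omega_{x:\sigma}(\varphi)\vdash\Omega_{x:\sigma}(\psi)\,[\Gamma]$. * For each $\Diamond\in\mathscr L_n$: from $\varphi_i\dashv\vdash\varphi_i'\,[\Gamma]$ for all $i$ infer $\Diamond(\varphi_1,\dots,\varphi_n)\vdash\Diamond(\varphi_1',\dots,\varphi_n')\,[\Gamma]$. * In both directions: $\Phi,\alpha,\beta,\Psi\vdash\theta\,[\Gamma]$ iff $\Phi,\alpha\otimes\beta,\Psi\vdash\theta\,[\Gamma]$; and $\Phi,e,\Psi\vdash\theta\,[\Gamma]$ iff $\Phi,\Psi\vdash\theta\,[\Gamma]$. $\mathrm{Ob}(\mathbf{FA})$ is the collection of pairs $(\mathcal C,P)$, where $\mathcal C$ is a category with designated finite products and $P:\mathcal C^{op}\to\mathbf{Pos}$ is a functor to posets and monotone maps, such that: 1. each $P(c)$ is an algebra for the connectives and each $P(f)$ is a homomorphism; 2. there is a designated $Eq_c\in P(c\times c)$ for each $c$; 3. for each $\Omega\in\mathscr L_q$ and each $c$ there are maps $\Omega_{b,c}:P(b\times c)\to P(b)$,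 natural in $b$; 4. $(P(c),\otimes,e)$ is a monoid for each $c$; 5. $\Omega_{b,1}\circ P(\pi_1^{b,1})=\mathrm{id}$ and $\Omega_{b,c\times d}\circ P(a_{b,c,d})=\Omega_{b,c}\circ\Omega_{b\times c,d}$, where $a_{b,c,d}:b\times(c\times d)\to(b\times c)\times d$ is the canonical isomorphism; 6. $Eq_1=e_{1\times1}$, and for $c=c_1\times c_2$, $Eq_c=P(\langle\pi_1\pi_1^{c,c},\pi_1\pi_2^{c,c}\rangle)Eq_{c_1}\otimes P(\langle\pi_2\pi_1^{c,c},\pi_2\pi_2^{c,c}\rangle)Eq_{c_2}$, where $\pi_i:c\to c_i$. An $Sg$-structure $S$ in $(\mathcal C,P)$ assigns to each sort an object, to each $f:\sigma_1,\dots,\sigma_n\to\tau$ a morphism $S[\![\sigma_1]\!]\times\cdots\times S[\![\sigma_n]\!]\to S[\![\tau]\!]$ and to each $R\subseteq\sigma_1,\dots,\sigma_n$ an element of $P(S[\![\sigma_1]\!]\times\cdots\times S[\![\sigma_n]\!])$. Terms and formulas are interpreted recursively: variables by projections, function symbols by composition, $R(M_1,\dots,M_n)$ and $M_1=_\sigma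 M_2$ by applying $P(\langle S[\![M_1]\!],\dots\rangle)$ to $S[\![R]\!]$ and to $Eq_{S[\![\sigma]\!]}$, connectives by the algebra operations, and $\Omega_{x:\sigma}(\varphi)\,[\Gamma]$ by $\Omega_{S[\![\Gamma]\!],S[\![\sigma]\!]}$ (after the canonical isomorphism $S[\![\Gamma]\!]\times S[\![\sigma]\!]\cong S[\![\Gamma,x:\sigma]\!]$). $S$ satisfies $M=M':\tau\,[\Gamma]$ if $S[\![M]\!]=S[\![M']\!]$, and satisfies $\varphi_1,\dots,\varphi_n\vdash\psi\,[\Gamma]$ if $S[\![\varphi_1]\!]\otimes\cdots\otimes S[\![\varphi_n]\!]\le S[\![\psi]\!]$ (the left side is $e$ if $n=0$). $\mathrm{Th}(S)$ is the set of assertions that $S$ satisfies, and $S$ is a $T$-model if $T\subseteq\mathrm{Th}(S)$. **Theorem.** Let $\mathcal L$ be a logic with $\mathcal L\supseteq\mathcal L^m$. Then $\mathcal L$ is adequate: for every signature $Sg$ and every $\mathcal L$-theory $T$ over $Sg$, the following data are well defined and form a prop-category $(\mathcal C_T,P_T)\in\mathrm{Ob}(\mathbf{FA})$, the classifying prop-category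 of $T$. * Objects are the contexts. Morphisms $\Gamma'\to[x_1:\sigma_1,\dots,x_n:\sigma_n]$ are lists $[N_1,\dots,N_n]$ of terms $N_i:\sigma_i\,[\Gamma']$, taken modulo $N\sim N'$ iff $N=N':\sigma\,[\Gamma']\in T$. Composition is component-wise substitution, identities are the lists of variables, the terminal object is $[\,]$, and $\Gamma\times\Gamma'=[\Gamma,\Gamma']$ with the evident projections. * $P_T(\Gamma)$ is the set of formulas $\varphi\,[\Gamma]$ modulo $\varphi\sim\psi$ iff $\varphi\vdash\psi\,[\Gamma]$ and $\psi\vdash\varphi\,[\Gamma]$ are in $T$, ordered by $[\varphi]\le[\psi]$ iff $\varphi\vdash\psi\,[\Gamma]\in T$; $P_T$ acts on morphisms by simultaneous substitution. * $\Diamond([\varphi_1],\dots,[\varphi_n])=[\Diamond(\varphi_1,\dots,\varphi_n)]$ (in particular for $e$ and $\otimes$), $\Omega_{\Gamma,\Gamma'}([\varphi])=[\Omega_{y_1:\tau_1}\cdots\Omega_{y_m:\tau_m}(\varphi)]$ for $\Gamma'=y_1:\tau_1,\dots,y_m:\tau_m$, and $Eq_\Gamma=[x_1=_{\sigma_1}x_1'\otimes\cdots\otimes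 x_n=_{\sigma_n}x_n']$ (which is $[e]$ for $n=0$). Moreover, let $G$ be the $Sg$-structure in $(\mathcal C_T,P_T)$ with $G[\![\sigma]\!]=[x:\sigma]$, $G[\![f]\!]=[f(x_1,\dots,x_n)]$ and $G[\![R]\!]=[R(x_1,\dots,x_n)]$. Then $G$ interprets every term-in-context and every formula-in-context as its own equivalence class, $G$ is a $T$-model, and $\mathrm{Th}(G)=T$ ($G$ is a generic $T$-model). -/

import Mathlib

open CategoryTheory Opposite MonoidalCategory CartesianMonoidalCategory

universe ℓ s o h p

set_option linter.checkUnivs false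

namespace PropLogic

/-! ## Syntax

Expressions are taken up to renaming of bound and of free variables, so a context is just a list
of sorts and a variable of a context is a position in it. Lists are read from right to left: the
context `[Γ, x : σ]` is `σ :: Γ`, and `[Γ, Γ']` is `Γ' ++ Γ`. -/

/-- A first-order language: quantifier symbols, propositional connectives with arities, and
designated connectives `e` (nullary) and `⊗` (binary). -/
structure FOLang : Type (ℓ + 1) where
  Quant : Type ℓ
  Conn : ℕ → Type ℓ
  e : Conn 0
  tensor : Conn 2

/-- A many-sorted signature. -/
structure Signature : Type (s + 1) where
  Sorts : Type s
  Fn : Type s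
  fnDom : Fn → List Sorts
  fnCod : Fn → Sorts
  Rel : Type s
  relDom : Rel → List Sorts

/-- Contexts. -/
abbrev Ctx (Sg : Signature.{s}) : Type s := List Sg.Sorts

/-- `Var Γ σ` is the type of variables of sort `σ` in the context `Γ`. -/
inductive Var {S : Type s} : List S → S → Type s
  | zero {Γ : List S} {σ : S} : Var (σ :: Γ) σ
  | succ {Γ : List S} {σ τ : S} (v : Var Γ σ) : Var (τ :: Γ) σ

namespace Var

variable {S : Type s}

/-- The inclusion of the variables of `Γ'` in those of `[Γ, Γ']`. -/
def inRight {Γ : List S} {σ : S} : {Γ' : List S} → Var Γ' σ → Var (Γ' ++ Γ) σ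
  | _, zero => zero
  | _, succ v => succ (inRight v)

/-- The inclusion of the variables of `Γ` in those of `[Γ, Γ']`. -/
def inLeft {Γ : List S} {σ : S} : (Γ' : List S) → Var Γ σ → Var (Γ' ++ Γ) σ
  | [], v => v
  | _ :: Γ', v => succ (inLeft Γ' v)

/-- A variable of `[Γ, Γ']` is a variable of `Γ'` or a variable of `Γ`. -/
def split {Γ : List S} {σ : S} : (Γ' : List S) → Var (Γ' ++ Γ) σ → Var Γ' σ ⊕ Var Γ σ
  | [], v => Sum.inr v
  | _ :: _, zero => Sum.inl zero
  | _ :: Γ', succ v => (split Γ' v).map succ id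

end Var

/-- `Term Sg Γ τ` is the type of terms-in-context `M : τ [Γ]`. The arguments of a function symbol
are indexed by the positions of its arity. -/
inductive Term (Sg : Signature.{s}) (Γ : Ctx Sg) : Sg.Sorts → Type s
  | var {σ : Sg.Sorts} (v : Var Γ σ) : Term Sg Γ σ
  | app (f : Sg.Fn) (args : ∀ ⦃σ : Sg.Sorts⦄, Var (Sg.fnDom f) σ → Term Sg Γ σ) :
      Term Sg Γ (Sg.fnCod f)

/-- `Sub Γ Δ` is the type of lists of terms in context `Γ`, one for each variable of `Δ`. -/
abbrev Sub {Sg : Signature.{s}} (Γ Δ : Ctx Sg) : Type s :=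
  ∀ ⦃σ : Sg.Sorts⦄, Var Δ σ → Term Sg Γ σ

/-- Sort-preserving maps from the variables of `Δ` to the variables of `Γ`. -/
abbrev Ren {Sg : Signature.{s}} (Γ Δ : Ctx Sg) : Type s :=
  ∀ ⦃σ : Sg.Sorts⦄, Var Δ σ → Var Γ σ

section
variable {Sg : Signature.{s}}

/-- Simultaneous substitution in terms. -/
def Term.subst {Γ Δ : Ctx Sg} (γ : Sub Γ Δ) : {τ : Sg.Sorts} → Term Sg Δ τ → Term Sg Γ τ
  | _, .var v => γ v
  | _, .app f args => .app f (fun _ v => (args v).subst γ)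

namespace Sub

/-- The variables of `Γ`, as a list of terms in context `Γ`. -/
def ids (Γ : Ctx Sg) : Sub Γ Γ := fun _ v => .var v

/-- A renaming of variables as a substitution. -/
def ofRen {Γ Δ : Ctx Sg} (ρ : Ren Γ Δ) : Sub Γ Δ := fun _ v => .var (ρ v)

/-- The substitution `Γ → [Γ]` omitting the last variable `x : σ` of `[Γ, x : σ]`. -/
def weak (Γ : Ctx Sg) (σ : Sg.Sorts) : Sub (σ :: Γ) Γ := ofRen (fun _ v => .succ v)

/-- The variables of `Γ`, in context `[Γ, Γ']`. -/
def projLeft (Γ Γ' : Ctx Sg) : Sub (Γ' ++ Γ) Γ := ofRen (fun _ v => v.inLeft Γ')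

/-- The variables of `Γ'`, in context `[Γ, Γ']`. -/
def projRight (Γ Γ' : Ctx Sg) : Sub (Γ' ++ Γ) Γ' := ofRen (fun _ v => v.inRight)

/-- Component-wise substitution. -/
def comp {Γ Δ Θ : Ctx Sg} (γ : Sub Γ Δ) (δ : Sub Δ Θ) : Sub Γ Θ := fun _ v => (δ v).subst γ

/-- Extension of a substitution by an additional variable `x : σ`, which is kept. -/
def lift {Γ Δ : Ctx Sg} (γ : Sub Γ Δ) (σ : Sg.Sorts) : Sub (σ :: Γ) (σ :: Δ)
  | _, .zero => .var .zero
  | _, .succ v => (γ v).subst (weak Γ σ)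

/-- The list with the single term `M`. -/
def single {Γ : Ctx Sg} {τ : Sg.Sorts} (M : Term Sg Γ τ) : Sub Γ [τ]
  | _, .zero => M

/-- The substitution `[M / x]` of a term `M : σ [Γ, Γ']` for the variable `x` of
`[Γ, x : σ, Γ']`; the other variables are kept. -/
def inst {Γ : Ctx Sg} (Γ' : Ctx Sg) {σ : Sg.Sorts} (M : Term Sg (Γ' ++ Γ) σ) :
    Sub (Γ' ++ Γ) (Γ' ++ σ :: Γ) := fun _ v =>
  match v.split Γ' with
  | .inl w => .var w.inRight
  | .inr .zero => M
  | .inr (.succ w) => .var (w.inLeft Γ')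

end Sub

end

/-- `Formula L Sg Γ` is the type of formulas-in-context `φ : prop [Γ]`. -/
inductive Formula (L : FOLang.{ℓ}) (Sg : Signature.{s}) : Ctx Sg → Type (max ℓ s)
  | rel {Γ : Ctx Sg} (R : Sg.Rel) (args : Sub Γ (Sg.relDom R)) : Formula L Sg Γ
  | eq {Γ : Ctx Sg} (σ : Sg.Sorts) (M N : Term Sg Γ σ) : Formula L Sg Γ
  | conn {Γ : Ctx Sg} {n : ℕ} (d : L.Conn n) (φ : Fin n → Formula L Sg Γ) : Formula L Sg Γ
  | quant {Γ : Ctx Sg} (Ω : L.Quant) (σ : Sg.Sorts) (φ : Formula L Sg (σ :: Γ)) : Formula L Sg Γ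

namespace Formula

variable {L : FOLang.{ℓ}} {Sg : Signature.{s}}

/-- Simultaneous capture-avoiding substitution in formulas. -/
def subst : {Γ Δ : Ctx Sg} → Sub Γ Δ → Formula L Sg Δ → Formula L Sg Γ
  | _, _, γ, .rel R args => .rel R (γ.comp args)
  | _, _, γ, .eq σ M N => .eq σ (M.subst γ) (N.subst γ)
  | _, _, γ, .conn d φ => .conn d (fun i => (φ i).subst γ)
  | _, _, γ, .quant Ω σ φ => .quant Ω σ (φ.subst (γ.lift σ))

/-- The formula `e`. -/
def e {Γ : Ctx Sg} : Formula L Sg Γ := .conn L.e ![]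

/-- The formula `φ ⊗ ψ`. -/
def tensor {Γ : Ctx Sg} (φ ψ : Formula L Sg Γ) : Formula L Sg Γ := .conn L.tensor ![φ, ψ]

/-- The formula `φ₁ ⊗ ⋯ ⊗ φₙ`, which is `e` for `n = 0`. -/
def tensorList {Γ : Ctx Sg} : List (Formula L Sg Γ) → Formula L Sg Γ
  | [] => e
  | [φ] => φ
  | φ :: ψ :: Φ => tensor φ (tensorList (ψ :: Φ))

/-- `Ω_{y₁:τ₁} ⋯ Ω_{yₘ:τₘ} φ [Γ]` for `φ [Γ, Γ']`, where `Γ' = y₁:τ₁, …, yₘ:τₘ`. -/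
def quants (Ω : L.Quant) {Γ : Ctx Sg} :
    (Γ' : Ctx Sg) → Formula L Sg (Γ' ++ Γ) → Formula L Sg Γ
  | [], φ => φ
  | τ :: Γ', φ => quants Ω Γ' (.quant Ω τ φ)

/-- The list of formulas `M₁ =_{σ₁} N₁, …, Mₙ =_{σₙ} Nₙ` of two lists of terms. -/
def eqList {Γ : Ctx Sg} : (Δ : Ctx Sg) → Sub Γ Δ → Sub Γ Δ → List (Formula L Sg Γ)
  | [], _, _ => []
  | σ :: Δ, γ, δ =>
      eqList Δ (fun _ v => γ v.succ) (fun _ v => δ v.succ) ++ [.eq σ (γ .zero) (δ .zero)]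

/-- `x₁ =_{σ₁} x₁' ⊗ ⋯ ⊗ xₙ =_{σₙ} xₙ' [Γ, Γ']`, where `Γ = x₁:σ₁, …, xₙ:σₙ` and
`Γ' = x₁':σ₁, …, xₙ':σₙ` is a copy of `Γ`. -/
def eqCtx (Γ : Ctx Sg) : Formula L Sg (Γ ++ Γ) :=
  tensorList (eqList Γ (Sub.projLeft Γ Γ) (Sub.projRight Γ Γ))

end Formula

/-! ## Theories and logics -/

/-- Assertions: equations-in-context and sequents-in-context. -/
inductive Assertion (L : FOLang.{ℓ}) (Sg : Signature.{s}) : Type (max ℓ s)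
  | eqn {Γ : Ctx Sg} {τ : Sg.Sorts} (M N : Term Sg Γ τ) : Assertion L Sg
  | seq {Γ : Ctx Sg} (Φ : List (Formula L Sg Γ)) (ψ : Formula L Sg Γ) : Assertion L Sg

/-- The complete lattice of theories over a signature. -/
abbrev Theory (L : FOLang.{ℓ}) (Sg : Signature.{s}) : Type (max ℓ s) := Set (Assertion L Sg)

section
open Assertion

/-- The theory `T` is closed under the rules of equational logic. The map `ρ` plays the role of
the inclusion of the variables of `Δ` in those of `[Γ, Γ']`. -/
structure EquationallyClosed {L : FOLang.{ℓ}} {Sg : Signature.{s}} (T : Theory L Sg) : Prop where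
  refl : ∀ {Γ : Ctx Sg} {σ : Sg.Sorts} (M : Term Sg Γ σ), eqn M M ∈ T
  symm : ∀ {Γ : Ctx Sg} {σ : Sg.Sorts} {M M' : Term Sg Γ σ}, eqn M M' ∈ T → eqn M' M ∈ T
  trans : ∀ {Γ : Ctx Sg} {σ : Sg.Sorts} {M M' M'' : Term Sg Γ σ},
    eqn M M' ∈ T → eqn M' M'' ∈ T → eqn M M'' ∈ T
  subst : ∀ {Γ Γ' Δ : Ctx Sg} {σ τ : Sg.Sorts} (ρ : Ren (Γ' ++ Γ) Δ),
    (∀ σ, Function.Injective (@ρ σ)) →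
    ∀ {M M' : Term Sg Δ σ} {N N' : Term Sg (Γ' ++ σ :: Γ) τ},
    eqn M M' ∈ T → eqn N N' ∈ T →
    eqn (N.subst (Sub.inst Γ' (M.subst (Sub.ofRen ρ))))
      (N'.subst (Sub.inst Γ' (M'.subst (Sub.ofRen ρ)))) ∈ T

/-- A (first-order) logic: a closure operator on the lattice of theories over each signature,
satisfying the rules of equational logic. -/
structure Logic (L : FOLang.{ℓ}) where
  cl : ∀ Sg : Signature.{s}, ClosureOperator (Theory L Sg)
  equational : ∀ (Sg : Signature.{s}) (T : Theory L Sg), EquationallyClosed (cl Sg T)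

/-- Derivability from `T` in the minimal logic `ℒᵐ`: the rules of equational logic together with
the sequent rules of `ℒᵐ`. -/
inductive MinDerivable {L : FOLang.{ℓ}} {Sg : Signature.{s}} (T : Theory L Sg) :
    Assertion L Sg → Prop
  | hyp {a : Assertion L Sg} : a ∈ T → MinDerivable T a
  | eqRefl {Γ : Ctx Sg} {σ : Sg.Sorts} (M : Term Sg Γ σ) : MinDerivable T (eqn M M)
  | eqSymm {Γ : Ctx Sg} {σ : Sg.Sorts} {M M' : Term Sg Γ σ} :
      MinDerivable T (eqn M M') → MinDerivable T (eqn M' M)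
  | eqTrans {Γ : Ctx Sg} {σ : Sg.Sorts} {M M' M'' : Term Sg Γ σ} :
      MinDerivable T (eqn M M') → MinDerivable T (eqn M' M'') → MinDerivable T (eqn M M'')
  | eqSubst {Γ Γ' Δ : Ctx Sg} {σ τ : Sg.Sorts} (ρ : Ren (Γ' ++ Γ) Δ)
      (hρ : ∀ σ, Function.Injective (@ρ σ))
      {M M' : Term Sg Δ σ} {N N' : Term Sg (Γ' ++ σ :: Γ) τ} :
      MinDerivable T (eqn M M') → MinDerivable T (eqn N N') →
      MinDerivable T (eqn (N.subst (Sub.inst Γ' (M.subst (Sub.ofRen ρ))))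
        (N'.subst (Sub.inst Γ' (M'.subst (Sub.ofRen ρ)))))
  | ax {Γ : Ctx Sg} (φ : Formula L Sg Γ) : MinDerivable T (seq [φ] φ)
  | cut {Γ : Ctx Sg} {φ ψ θ : Formula L Sg Γ} :
      MinDerivable T (seq [φ] ψ) → MinDerivable T (seq [ψ] θ) → MinDerivable T (seq [φ] θ)
  | cwk {Γ : Ctx Sg} (σ : Sg.Sorts) {Φ : List (Formula L Sg Γ)} {ψ : Formula L Sg Γ} :
      MinDerivable T (seq Φ ψ) →
      MinDerivable T (seq (Φ.map (Formula.subst (Sub.weak Γ σ))) (ψ.subst (Sub.weak Γ σ)))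
  | sub {Γ Γ' Δ : Ctx Sg} {σ : Sg.Sorts} (ρ : Ren (Γ' ++ Γ) Δ)
      (hρ : ∀ σ, Function.Injective (@ρ σ))
      {M M' : Term Sg Δ σ} {Φ : List (Formula L Sg (Γ' ++ σ :: Γ))}
      {ψ : Formula L Sg (Γ' ++ σ :: Γ)} :
      MinDerivable T (eqn M M') → MinDerivable T (seq Φ ψ) →
      MinDerivable T (seq (Φ.map (Formula.subst (Sub.inst Γ' (M.subst (Sub.ofRen ρ)))))
        (ψ.subst (Sub.inst Γ' (M'.subst (Sub.ofRen ρ)))))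
  | quantCong {Γ : Ctx Sg} (Ω : L.Quant) {σ : Sg.Sorts} {φ ψ : Formula L Sg (σ :: Γ)} :
      MinDerivable T (seq [φ] ψ) → MinDerivable T (seq [ψ] φ) →
      MinDerivable T (seq [.quant Ω σ φ] (.quant Ω σ ψ))
  | connCong {Γ : Ctx Sg} {n : ℕ} (d : L.Conn n) {φ φ' : Fin n → Formula L Sg Γ} :
      (∀ i, MinDerivable T (seq [φ i] (φ' i))) → (∀ i, MinDerivable T (seq [φ' i] (φ i))) →
      MinDerivable T (seq [.conn d φ] (.conn d φ'))
  | tensorIntro {Γ : Ctx Sg} {Φ Ψ : List (Formula L Sg Γ)} {α β θ : Formula L Sg Γ} :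
      MinDerivable T (seq (Φ ++ α :: β :: Ψ) θ) →
      MinDerivable T (seq (Φ ++ α.tensor β :: Ψ) θ)
  | tensorElim {Γ : Ctx Sg} {Φ Ψ : List (Formula L Sg Γ)} {α β θ : Formula L Sg Γ} :
      MinDerivable T (seq (Φ ++ α.tensor β :: Ψ) θ) →
      MinDerivable T (seq (Φ ++ α :: β :: Ψ) θ)
  | unitElim {Γ : Ctx Sg} {Φ Ψ : List (Formula L Sg Γ)} {θ : Formula L Sg Γ} :
      MinDerivable T (seq (Φ ++ Formula.e :: Ψ) θ) → MinDerivable T (seq (Φ ++ Ψ) θ)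
  | unitIntro {Γ : Ctx Sg} {Φ Ψ : List (Formula L Sg Γ)} {θ : Formula L Sg Γ} :
      MinDerivable T (seq (Φ ++ Ψ) θ) → MinDerivable T (seq (Φ ++ Formula.e :: Ψ) θ)

end

theorem MinDerivable.bind {L : FOLang.{ℓ}} {Sg : Signature.{s}} {T T' : Theory L Sg}
    (hT : ∀ a ∈ T, MinDerivable T' a) {a : Assertion L Sg} (ha : MinDerivable T a) :
    MinDerivable T' a := by
  induction ha with
  | hyp h => exact hT _ h
  | eqRefl M => exact .eqRefl M
  | eqSymm _ h => exact .eqSymm h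
  | eqTrans _ _ h h' => exact .eqTrans h h'
  | eqSubst ρ hρ _ _ h h' => exact .eqSubst ρ hρ h h'
  | ax φ => exact .ax φ
  | cut _ _ h h' => exact .cut h h'
  | cwk σ _ h => exact .cwk σ h
  | sub ρ hρ _ _ h h' => exact .sub ρ hρ h h'
  | quantCong Ω _ _ h h' => exact .quantCong Ω h h'
  | connCong d _ _ h h' => exact .connCong d h h'
  | tensorIntro _ h => exact .tensorIntro h
  | tensorElim _ h => exact .tensorElim h
  | unitElim _ h => exact .unitElim h
  | unitIntro _ h => exact .unitIntro h

namespace Logic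

variable {L : FOLang.{ℓ}}

/-- The minimal logic `ℒᵐ`. -/
def minimal (L : FOLang.{ℓ}) : Logic.{ℓ, s} L where
  cl _ := ClosureOperator.mk'
    (fun T => {a | MinDerivable T a})
    (fun _ _ h _ ha => MinDerivable.bind (fun _ hb => .hyp (h hb)) ha)
    (fun _ _ ha => .hyp ha)
    (fun _ _ ha => MinDerivable.bind (fun _ hb => hb) ha)
  equational _ _ :=
    { refl := fun M => .eqRefl M
      symm := fun h => .eqSymm h
      trans := fun h h' => .eqTrans h h'
      subst := fun ρ hρ _ _ _ _ h h' => .eqSubst ρ hρ h h' }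

/-- `ℒ₂` contains `ℒ₁`: everything derivable in `ℒ₁` is derivable in `ℒ₂`. -/
def Contains (ℒ₂ ℒ₁ : Logic.{ℓ, s} L) : Prop :=
  ∀ (Sg : Signature.{s}) (T : Theory L Sg), ℒ₁.cl Sg T ⊆ ℒ₂.cl Sg T

/-- `T` is an `ℒ`-theory. -/
def IsTheory (ℒ : Logic.{ℓ, s} L) {Sg : Signature.{s}} (T : Theory L Sg) : Prop :=
  ℒ.cl Sg T = T

end Logic

/-! ## Prop-categories -/

/-- The prop-categories in `FA`: a category `C` with designated finite products, a contravariant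
functor `P` to posets, and the following structure. The designated monoid operation and unit of
`P(c)` are the interpretations of the designated connectives `⊗` and `e`. -/
structure FA (L : FOLang.{ℓ}) where
  C : Type o
  [category : Category.{h} C]
  [products : CartesianMonoidalCategory C]
  P : Cᵒᵖ ⥤ PartOrd.{p}
  conn : ∀ (c : C) {n : ℕ}, L.Conn n → (Fin n → P.obj (op c)) → P.obj (op c)
  conn_natural : ∀ {b c : C} (f : b ⟶ c) {n : ℕ} (d : L.Conn n) (q : Fin n → P.obj (op c)),
    P.map f.op (conn c d q) = conn b d (fun i => P.map f.op (q i))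
  Eq : ∀ c : C, P.obj (op (c ⊗ c))
  quant : L.Quant → ∀ b c : C, P.obj (op (b ⊗ c)) → P.obj (op b)
  quant_natural : ∀ (Ω : L.Quant) {b b' : C} (f : b' ⟶ b) (c : C) (q : P.obj (op (b ⊗ c))),
    P.map f.op (quant Ω b c q) = quant Ω b' c (P.map (f ▷ c).op q)
  tensor_assoc : ∀ (c : C) (x y z : P.obj (op c)),
    conn c L.tensor ![conn c L.tensor ![x, y], z] = conn c L.tensor ![x, conn c L.tensor ![y, z]]
  unit_tensor : ∀ (c : C) (x : P.obj (op c)), conn c L.tensor ![conn c L.e ![], x] = x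
  tensor_unit : ∀ (c : C) (x : P.obj (op c)), conn c L.tensor ![x, conn c L.e ![]] = x
  quant_one : ∀ (Ω : L.Quant) (b : C) (q : P.obj (op b)),
    quant Ω b (𝟙_ C) (P.map (fst b (𝟙_ C)).op q) = q
  quant_prod : ∀ (Ω : L.Quant) (b c d : C) (q : P.obj (op ((b ⊗ c) ⊗ d))),
    quant Ω b (c ⊗ d) (P.map (α_ b c d).inv.op q) = quant Ω b c (quant Ω (b ⊗ c) d q)
  Eq_one : Eq (𝟙_ C) = conn (𝟙_ C ⊗ 𝟙_ C) L.e ![]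
  Eq_prod : ∀ c₁ c₂ : C, Eq (c₁ ⊗ c₂) = conn ((c₁ ⊗ c₂) ⊗ (c₁ ⊗ c₂)) L.tensor
    ![P.map (lift (fst (c₁ ⊗ c₂) (c₁ ⊗ c₂) ≫ fst c₁ c₂)
        (snd (c₁ ⊗ c₂) (c₁ ⊗ c₂) ≫ fst c₁ c₂)).op (Eq c₁),
      P.map (lift (fst (c₁ ⊗ c₂) (c₁ ⊗ c₂) ≫ snd c₁ c₂)
        (snd (c₁ ⊗ c₂) (c₁ ⊗ c₂) ≫ snd c₁ c₂)).op (Eq c₂)]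

attribute [instance] FA.category FA.products

namespace FA

variable {L : FOLang.{ℓ}} (X : FA.{ℓ, o, h, p} L)

/-- The poset `P(c)`. -/
abbrev Pr (c : X.C) : Type p := X.P.obj (op c)

/-- The map `P(f)`. -/
abbrev pull {b c : X.C} (f : b ⟶ c) : X.Pr c → X.Pr b := fun q => X.P.map f.op q

/-- `q₁ ⊗ ⋯ ⊗ qₙ` in the monoid `P(c)`, which is `e` for `n = 0`. -/
def tensorList (c : X.C) (qs : List (X.Pr c)) : X.Pr c :=
  qs.foldr (fun q r => X.conn c L.tensor ![q, r]) (X.conn c L.e ![])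

end FA

section
variable {C : Type o} [Category.{h} C] [CartesianMonoidalCategory C] {S : Type s}

/-- The product `⟦σ₁⟧ × ⋯ × ⟦σₙ⟧`; it is `1` for `n = 0` and `⟦σ₁⟧` for `n = 1`. -/
def ctxObj (I : S → C) : List S → C
  | [] => 𝟙_ C
  | [σ] => I σ
  | σ :: τ :: Γ => ctxObj I (τ :: Γ) ⊗ I σ

/-- The projections of `⟦σ₁⟧ × ⋯ × ⟦σₙ⟧`. -/
def ctxProj (I : S → C) : {Γ : List S} → {σ : S} → Var Γ σ → (ctxObj I Γ ⟶ I σ)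
  | [_], _, .zero => 𝟙 _
  | _ :: _ :: _, _, .zero => snd _ _
  | _ :: _ :: _, _, .succ v => fst _ _ ≫ ctxProj I v

/-- The morphism `⟨f₁, …, fₙ⟩` to `⟦σ₁⟧ × ⋯ × ⟦σₙ⟧`. -/
def ctxTuple (I : S → C) {c : C} :
    (Γ : List S) → (∀ ⦃σ : S⦄, Var Γ σ → (c ⟶ I σ)) → (c ⟶ ctxObj I Γ)
  | [], _ => toUnit c
  | [_], f => f .zero
  | _ :: τ :: Γ, f => lift (ctxTuple I (τ :: Γ) (fun _ v => f v.succ)) (f .zero)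

/-- The change-in-product isomorphism `⟦Γ⟧ × ⟦x : σ⟧ → ⟦Γ, x : σ⟧`. -/
def ctxExt (I : S → C) (σ : S) : (Γ : List S) → (ctxObj I Γ ⊗ I σ ⟶ ctxObj I (σ :: Γ))
  | [] => snd _ _
  | _ :: _ => 𝟙 _

end

/-! ## Structures -/

/-- A structure for a signature in a prop-category. -/
structure Struct {L : FOLang.{ℓ}} (Sg : Signature.{s}) (X : FA.{ℓ, o, h, p} L) where
  sort : Sg.Sorts → X.C
  fn : ∀ f : Sg.Fn, ctxObj sort (Sg.fnDom f) ⟶ sort (Sg.fnCod f)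
  rel : ∀ R : Sg.Rel, X.Pr (ctxObj sort (Sg.relDom R))

namespace Struct

variable {L : FOLang.{ℓ}} {Sg : Signature.{s}} {X : FA.{ℓ, o, h, p} L} (S : Struct Sg X)

/-- The object `⟦Γ⟧`. -/
abbrev ctx (Γ : Ctx Sg) : X.C := ctxObj S.sort Γ

/-- The interpretation `⟦M : τ [Γ]⟧` of terms. -/
def term {Γ : Ctx Sg} : {τ : Sg.Sorts} → Term Sg Γ τ → (S.ctx Γ ⟶ S.sort τ)
  | _, .var v => ctxProj S.sort v
  | _, .app f args => ctxTuple S.sort (Sg.fnDom f) (fun _ v => term (args v)) ≫ S.fn f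

/-- The morphism `⟨⟦M₁⟧, …, ⟦Mₙ⟧⟩`. -/
def terms {Γ Δ : Ctx Sg} (γ : Sub Γ Δ) : S.ctx Γ ⟶ S.ctx Δ :=
  ctxTuple S.sort Δ (fun _ v => S.term (γ v))

/-- The interpretation `⟦φ [Γ]⟧` of formulas. -/
def form : {Γ : Ctx Sg} → Formula L Sg Γ → X.Pr (S.ctx Γ)
  | _, .rel R args => X.pull (S.terms args) (S.rel R)
  | _, .eq σ M N => X.pull (lift (S.term M) (S.term N)) (X.Eq (S.sort σ))
  | Γ, .conn d φ => X.conn (S.ctx Γ) d (fun i => form (φ i))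
  | Γ, .quant Ω σ φ =>
      X.quant Ω (S.ctx Γ) (S.sort σ) (X.pull (ctxExt S.sort σ Γ) (form φ))

/-- Satisfaction of an assertion. -/
def Satisfies : Assertion L Sg → Prop
  | .eqn M N => S.term M = S.term N
  | .seq (Γ := Γ) Φ ψ => X.tensorList (S.ctx Γ) (Φ.map S.form) ≤ S.form ψ

/-- The theory of a structure. -/
def Th : Theory L Sg := {a | S.Satisfies a}

/-- `S` is a `T`-model. -/
def IsModel (T : Theory L Sg) : Prop := T ≤ S.Th

end Struct

/-! ## The classifying prop-category -/

/-- `Classifying T X` exhibits the prop-category `X` as the classifying prop-category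
`(C_T, P_T)`, which this determines up to isomorphism: the objects are the contexts, the morphisms
`Γ → Δ` are the lists of terms in context `Γ` (one for each variable of `Δ`) modulo provable
equality in `T`, with composition by substitution and products by concatenation of contexts; the
elements of `P_T(Γ)` are the formulas in context `Γ` modulo interderivability in `T`, ordered by
derivability; all operations are given on representatives by the syntax. -/
structure Classifying {L : FOLang.{ℓ}} {Sg : Signature.{s}} (T : Theory L Sg)
    (X : FA.{ℓ, o, h, p} L) where
  /-- The objects are the contexts. -/
  obj : Ctx Sg ≃ X.C
  /-- The morphism given by a list of terms. -/
  hom : ∀ {Γ Δ : Ctx Sg}, Sub Γ Δ → (obj Γ ⟶ obj Δ)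
  hom_surjective : ∀ Γ Δ : Ctx Sg, Function.Surjective (hom : Sub Γ Δ → (obj Γ ⟶ obj Δ))
  hom_eq_iff : ∀ {Γ Δ : Ctx Sg} (γ δ : Sub Γ Δ),
    hom γ = hom δ ↔ ∀ (σ : Sg.Sorts) (v : Var Δ σ), Assertion.eqn (γ v) (δ v) ∈ T
  hom_id : ∀ Γ : Ctx Sg, hom (Sub.ids Γ) = 𝟙 (obj Γ)
  hom_comp : ∀ {Γ Δ Θ : Ctx Sg} (γ : Sub Γ Δ) (δ : Sub Δ Θ), hom γ ≫ hom δ = hom (γ.comp δ)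
  /-- The terminal object is the empty context. -/
  obj_nil : obj [] = 𝟙_ X.C
  /-- The product of `Γ` and `Γ'` is `[Γ, Γ']`, with the evident projections. -/
  obj_append : ∀ Γ Γ' : Ctx Sg, obj (Γ' ++ Γ) = obj Γ ⊗ obj Γ'
  proj_left : ∀ Γ Γ' : Ctx Sg,
    eqToHom (obj_append Γ Γ') ≫ fst (obj Γ) (obj Γ') = hom (Sub.projLeft Γ Γ')
  proj_right : ∀ Γ Γ' : Ctx Sg,
    eqToHom (obj_append Γ Γ') ≫ snd (obj Γ) (obj Γ') = hom (Sub.projRight Γ Γ')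
  /-- The class of a formula. -/
  cls : ∀ {Γ : Ctx Sg}, Formula L Sg Γ → X.Pr (obj Γ)
  cls_surjective : ∀ Γ : Ctx Sg, Function.Surjective (cls : Formula L Sg Γ → X.Pr (obj Γ))
  cls_le_iff : ∀ {Γ : Ctx Sg} (φ ψ : Formula L Sg Γ),
    cls φ ≤ cls ψ ↔ Assertion.seq [φ] ψ ∈ T
  pull_cls : ∀ {Γ Δ : Ctx Sg} (γ : Sub Γ Δ) (φ : Formula L Sg Δ),
    X.pull (hom γ) (cls φ) = cls (φ.subst γ)
  conn_cls : ∀ {Γ : Ctx Sg} {n : ℕ} (d : L.Conn n) (φ : Fin n → Formula L Sg Γ),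
    X.conn (obj Γ) d (fun i => cls (φ i)) = cls (.conn d φ)
  quant_cls : ∀ (Ω : L.Quant) (Γ Γ' : Ctx Sg) (φ : Formula L Sg (Γ' ++ Γ)),
    X.quant Ω (obj Γ) (obj Γ') (X.pull (eqToHom (obj_append Γ Γ').symm) (cls φ)) =
      cls (φ.quants Ω Γ')
  Eq_cls : ∀ Γ : Ctx Sg,
    X.Eq (obj Γ) = X.pull (eqToHom (obj_append Γ Γ).symm) (cls (Formula.eqCtx Γ))

namespace Classifying

variable {L : FOLang.{ℓ}} {Sg : Signature.{s}} {T : Theory L Sg} {X : FA.{ℓ, o, h, p} L}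
  (K : Classifying T X)

/-- The context `[x₁ : σ₁, …, xₙ : σₙ]` is the product of the contexts `[xᵢ : σᵢ]`. -/
theorem ctxObj_eq : ∀ Γ : Ctx Sg, ctxObj (fun σ => K.obj [σ]) Γ = K.obj Γ
  | [] => K.obj_nil.symm
  | [_] => rfl
  | σ :: τ :: Γ => by
      rw [ctxObj, ctxObj_eq (τ :: Γ)]
      exact (K.obj_append (τ :: Γ) [σ]).symm

/-- The generic structure: `σ` is interpreted by the context `[x : σ]`, a function symbol `f` by
the class of `f(x₁, …, xₙ) [Γ]` and a relation symbol `R` by the class of `R(x₁, …, xₙ) [Γ]`. -/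
def generic : Struct Sg X where
  sort σ := K.obj [σ]
  fn f := eqToHom (K.ctxObj_eq (Sg.fnDom f)) ≫
    K.hom (Sub.single (Term.app f (Sub.ids (Sg.fnDom f))))
  rel R := X.pull (eqToHom (K.ctxObj_eq (Sg.relDom R)))
    (K.cls (Formula.rel R (Sub.ids (Sg.relDom R))))

end Classifying

/-- A logic is adequate if each of its theories `T` has a classifying prop-category
`(C_T, P_T)` in `FA`, in which the generic structure `G` is a `T`-model with `Th(G) = T` that
interprets each term and each formula in context as its class modulo `T`. -/
def Logic.Adequate {L : FOLang.{ℓ}} (ℒ : Logic.{ℓ, s} L) : Prop :=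
  ∀ (Sg : Signature.{s}) (T : Theory L Sg), ℒ.IsTheory T →
    ∃ (X : FA.{ℓ, s, s, max ℓ s} L) (K : Classifying T X),
      K.generic.IsModel T ∧ K.generic.Th = T ∧
      (∀ (Γ : Ctx Sg) (τ : Sg.Sorts) (M : Term Sg Γ τ),
        K.generic.term M = eqToHom (K.ctxObj_eq Γ) ≫ K.hom (Sub.single M)) ∧
      (∀ (Γ : Ctx Sg) (φ : Formula L Sg Γ),
        K.generic.form φ = X.pull (eqToHom (K.ctxObj_eq Γ)) (K.cls φ))

end PropLogic

namespace PropLogic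

/-! ## Variables and substitutions -/

namespace Var

variable {S : Type s} {Γ Γ' : List S} {σ : S}

/-! The prop-category is the term model, and every clause about it reduces to a fact about
substitution or to a rule of the minimal logic. Containment of the minimal logic makes an `ℒ`-theory
`T` closed under `MinDerivable`, so the construction can be made from derivability and compared with
membership in `T` only at the end.

The main difficulty is that composition and reindexing use simultaneous substitution, while the
rules replace one variable at a time. Replacing the variables of `Δ` successively by terms over `Γ`
could capture variables shared by the two contexts. This is avoided by weakening to `[Δ, Γ]`, with
the two blocks kept disjoint, and then eliminating the variables of `Δ` one by one; `eqn_subst` and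
`seq_subst` result. They make composition and `P_T` well defined. The congruence rules do the same
for connectives and quantifiers, and the two-way rules for `⊗` and `e` give the monoid laws, because
formulas with the same consequences are equal in the quotient. Naturality and the laws for iterated
quantifiers are syntactic identities (`subst_quants`, `quants_append`); the product law for equality
uses the decomposition in `eqList_append`.

For the generic structure, induction on terms and formulas (`generic_term`, `generic_form`)
identifies each interpretation with a class. An equation then holds exactly when two classes of
terms agree, and a sequent exactly when the tensor of its antecedents entails its conclusion;
`seq_tensorList` turns this back into the original sequent, so `Th(G) = T`. -/

@[simp] theorem split_inRight : ∀ {Γ' : List S} (v : Var Γ' σ),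
    split (Γ := Γ) Γ' v.inRight = Sum.inl v
  | _, .zero => rfl
  | _, .succ v => by simp [inRight, split, split_inRight v]

@[simp] theorem split_inLeft : ∀ (Γ' : List S) (v : Var Γ σ), split Γ' (v.inLeft Γ') = Sum.inr v
  | [], _ => rfl
  | _ :: Γ', v => by simp [inLeft, split, split_inLeft Γ' v]

theorem append_cases {motive : Var (Γ' ++ Γ) σ → Prop}
    (left : ∀ v : Var Γ σ, motive (v.inLeft Γ')) (right : ∀ v : Var Γ' σ, motive v.inRight)
    (v : Var (Γ' ++ Γ) σ) : motive v := by
  induction Γ' with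
  | nil => exact left v
  | cons τ Γ' ih =>
    cases v with
    | zero => exact right .zero
    | succ v => exact ih (motive := fun v => motive v.succ) left (fun w => right w.succ) v

theorem inRight_injective : Function.Injective (inRight : Var Γ' σ → Var (Γ' ++ Γ) σ) :=
  fun v w hvw => by simpa using congrArg (split Γ') hvw

theorem inLeft_injective (Γ' : List S) :
    Function.Injective (inLeft Γ' : Var Γ σ → Var (Γ' ++ Γ) σ) :=
  fun v w hvw => by simpa using congrArg (split Γ') hvw

/-- The isomorphism between the contexts `[[Γ, Δ], Θ]` and `[Γ, [Δ, Θ]]`, as a renaming. -/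
def assoc {Γ Δ : List S} {σ : S} : (Θ : List S) → Var (Θ ++ (Δ ++ Γ)) σ → Var ((Θ ++ Δ) ++ Γ) σ
  | [], v => v
  | _ :: _, .zero => .zero
  | _ :: Θ, .succ v => .succ (assoc Θ v)

theorem assoc_inLeft_inLeft {Δ : List S} (v : Var Γ σ) : ∀ Θ : List S,
    assoc Θ ((v.inLeft Δ).inLeft Θ) = v.inLeft (Θ ++ Δ)
  | [] => rfl
  | _ :: Θ => congrArg succ (assoc_inLeft_inLeft v Θ)

theorem assoc_inLeft_inRight {Δ : List S} (v : Var Δ σ) : ∀ Θ : List S,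
    assoc Θ ((v.inRight : Var (Δ ++ Γ) σ).inLeft Θ) = (v.inLeft Θ).inRight
  | [] => rfl
  | _ :: Θ => congrArg succ (assoc_inLeft_inRight v Θ)

theorem assoc_inRight {Δ : List S} : ∀ {Θ : List S} (v : Var Θ σ),
    assoc Θ (v.inRight : Var (Θ ++ (Δ ++ Γ)) σ) = (v.inRight : Var (Θ ++ Δ) σ).inRight
  | _, .zero => rfl
  | _, .succ v => congrArg succ (assoc_inRight v)

theorem cast_succ {Γ Δ : List S} (hΓ : Γ = Δ) (τ : S) (v : Var Γ σ) :
    (congrArg (τ :: ·) hΓ : τ :: Γ = τ :: Δ) ▸ v.succ = (hΓ ▸ v).succ := by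
  subst hΓ; rfl

theorem cast_zero {Γ Δ : List S} (hΓ : Γ = Δ) (τ : S) :
    (congrArg (τ :: ·) hΓ : τ :: Γ = τ :: Δ) ▸ (Var.zero : Var (τ :: Γ) τ) = .zero := by
  subst hΓ; rfl

/-- Appending the empty list on the right gives back `Γ` only propositionally. This transport
appears when all variables of `Δ` have been eliminated from `[Δ, Γ]`. -/
theorem cast_inRight_nil : ∀ {Γ : List S} (v : Var Γ σ),
    (List.append_nil Γ) ▸ (v.inRight : Var (Γ ++ []) σ) = v
  | _ :: Γ, .zero => cast_zero (List.append_nil Γ) _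
  | τ :: Γ, .succ v => (cast_succ (List.append_nil Γ) τ _).trans
      (congrArg succ (cast_inRight_nil v))

end Var

section
variable {L : FOLang.{ℓ}} {Sg : Signature.{s}} {Γ Δ Θ Ξ : Ctx Sg}

theorem Term.subst_ids : ∀ {τ : Sg.Sorts} (M : Term Sg Γ τ), M.subst (Sub.ids Γ) = M
  | _, .var _ => rfl
  | _, .app f args => by
      simp only [Term.subst]
      congr; funext σ v; exact Term.subst_ids (args v)

theorem Term.subst_subst (γ : Sub Γ Δ) (δ : Sub Δ Θ) : ∀ {τ : Sg.Sorts} (M : Term Sg Θ τ),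
    (M.subst δ).subst γ = M.subst (γ.comp δ)
  | _, .var _ => rfl
  | _, .app f args => by
      simp only [Term.subst]
      congr; funext σ v; exact Term.subst_subst γ δ (args v)

namespace Sub

@[simp] theorem comp_ids (γ : Sub Γ Δ) : γ.comp (ids Δ) = γ := rfl

@[simp] theorem ids_comp (γ : Sub Γ Δ) : (ids Γ).comp γ = γ :=
  funext fun _ => funext fun v => (γ v).subst_ids

theorem comp_assoc (γ : Sub Γ Δ) (δ : Sub Δ Θ) (θ : Sub Θ Ξ) :
    (γ.comp δ).comp θ = γ.comp (δ.comp θ) :=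
  funext fun _ => funext fun v => ((θ v).subst_subst γ δ).symm

theorem cons_ext {σ : Sg.Sorts} {γ δ : Sub Γ (σ :: Δ)} (h0 : γ .zero = δ .zero)
    (hs : ∀ ⦃τ⦄ (v : Var Δ τ), γ v.succ = δ v.succ) : γ = δ := by
  funext τ v
  cases v with
  | zero => exact h0
  | succ v => exact hs v

theorem append_ext {γ δ : Sub Γ (Θ ++ Δ)}
    (hl : ∀ ⦃τ⦄ (v : Var Δ τ), γ (v.inLeft Θ) = δ (v.inLeft Θ))
    (hr : ∀ ⦃τ⦄ (v : Var Θ τ), γ v.inRight = δ v.inRight) : γ = δ := by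
  funext τ v
  exact Var.append_cases (motive := fun v => γ v = δ v) (@hl τ) (@hr τ) v

@[simp] theorem lift_ids (σ : Sg.Sorts) : (ids Γ).lift σ = ids (σ :: Γ) :=
  cons_ext rfl fun _ _ => rfl

theorem lift_comp_weak (γ : Sub Γ Δ) (σ : Sg.Sorts) :
    (γ.lift σ).comp (weak Δ σ) = (weak Γ σ).comp γ := rfl

/-- On the kept variables both sides weaken and substitute, and `γ.lift σ` after a weakening is the
weakening after `γ`. This is what lets substitution pass under a quantifier functorially. -/
theorem lift_comp (γ : Sub Γ Δ) (δ : Sub Δ Θ) (σ : Sg.Sorts) :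
    (γ.lift σ).comp (δ.lift σ) = (γ.comp δ).lift σ :=
  cons_ext rfl fun _ v => ((δ v).subst_subst _ _).trans ((δ v).subst_subst (weak Γ σ) γ).symm

/-- The list of terms consisting of `γ` and `δ`. -/
def pair (Θ : Ctx Sg) (γ : Sub Γ Δ) (δ : Sub Γ Θ) : Sub Γ (Θ ++ Δ) :=
  fun _ v => (v.split Θ).elim (fun w => δ w) (fun w => γ w)

@[simp] theorem pair_inLeft (γ : Sub Γ Δ) (δ : Sub Γ Θ) {σ : Sg.Sorts} (v : Var Δ σ) :
    pair Θ γ δ (v.inLeft Θ) = γ v := by simp [pair]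

@[simp] theorem pair_inRight (γ : Sub Γ Δ) (δ : Sub Γ Θ) {σ : Sg.Sorts} (v : Var Θ σ) :
    pair Θ γ δ v.inRight = δ v := by simp [pair]

@[simp] theorem pair_comp_projLeft (γ : Sub Γ Δ) (δ : Sub Γ Θ) :
    (pair Θ γ δ).comp (projLeft Δ Θ) = γ :=
  funext fun _ => funext fun v => pair_inLeft γ δ v

@[simp] theorem pair_comp_projRight (γ : Sub Γ Δ) (δ : Sub Γ Θ) :
    (pair Θ γ δ).comp (projRight Δ Θ) = δ :=
  funext fun _ => funext fun v => pair_inRight γ δ v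

theorem projLeft_cons (σ : Sg.Sorts) :
    projLeft Γ (σ :: Δ) = (weak (Δ ++ Γ) σ).comp (projLeft Γ Δ) := rfl

theorem single_zero {σ : Sg.Sorts} (γ : Sub Γ [σ]) :
    single (γ .zero) = γ :=
  cons_ext rfl fun _ v => nomatch v

theorem comp_single (γ : Sub Γ Δ) {σ : Sg.Sorts} (M : Term Sg Δ σ) :
    γ.comp (single M) = single (M.subst γ) :=
  (single_zero _).symm

/-- Extension of a substitution by a list of additional variables, which are kept. -/
def lifts (γ : Sub Γ Δ) : (Θ : Ctx Sg) → Sub (Θ ++ Γ) (Θ ++ Δ)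
  | [] => γ
  | σ :: Θ => (γ.lifts Θ).lift σ

theorem lifts_comp_projLeft (γ : Sub Γ Δ) : ∀ Θ : Ctx Sg,
    (γ.lifts Θ).comp (projLeft Δ Θ) = (projLeft Γ Θ).comp γ
  | [] => (ids_comp γ).symm
  | σ :: Θ => by
      rw [projLeft_cons, ← comp_assoc, lifts, lift_comp_weak, comp_assoc, lifts_comp_projLeft γ Θ,
        ← comp_assoc, projLeft_cons]

theorem lifts_comp_projRight (γ : Sub Γ Δ) : ∀ Θ : Ctx Sg,
    (γ.lifts Θ).comp (projRight Δ Θ) = projRight Γ Θ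
  | [] => funext fun _ => funext fun v => nomatch v
  | σ :: Θ => cons_ext rfl fun _ v =>
      congrArg (Term.subst (weak _ σ)) (congrFun (congrFun (lifts_comp_projRight γ Θ) _) v)

theorem pair_nil_ids (γ : Sub Γ []) :
    pair Γ γ (ids Γ) = ofRen fun _ v => List.append_nil Γ ▸ v :=
  append_ext (fun _ v => nomatch v) fun _ v => by
    rw [pair_inRight]
    exact congrArg Term.var (Var.cast_inRight_nil v).symm

theorem ofRen_assoc_cons (σ : Sg.Sorts) :
    (ofRen fun _ v => Var.assoc (σ :: Θ) v : Sub (((σ :: Θ) ++ Δ) ++ Γ) _) =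
      (ofRen fun _ v => Var.assoc Θ v).lift σ :=
  cons_ext rfl fun _ _ => rfl

/-- Substituting the first of the terms of a list and then the others. -/
theorem pair_ids_eq_comp_inst {σ : Sg.Sorts} (γ : Sub Γ (σ :: Δ)) :
    pair Γ γ (ids Γ) = (pair Γ (fun _ v => γ v.succ) (ids Γ)).comp
      (inst Γ ((γ .zero).subst (ofRen fun _ v => v.inRight))) := by
  refine append_ext (fun τ v => ?_) fun τ v => ?_
  · rw [pair_inLeft, comp, inst, Var.split_inLeft]
    cases v with
    | zero =>
      -- The inserted term involves only the variables of the block `Γ`, which the remaining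
      -- substitution fixes, so it is left unchanged.
      exact (Term.subst_ids _).symm.trans
        ((congrArg (Term.subst · _) (pair_comp_projRight _ _).symm).trans
          (Term.subst_subst _ _ _).symm)
    | succ v => exact (pair_inLeft (fun _ v => γ v.succ) (ids Γ) v).symm
  · rw [pair_inRight, comp, inst, Var.split_inRight]
    exact (pair_inRight _ _ v).symm

end Sub

/-! ### Substitution in formulas, iterated quantifiers and lists of equations -/

namespace Formula

theorem subst_ids {Γ : Ctx Sg} (φ : Formula L Sg Γ) : φ.subst (Sub.ids Γ) = φ := by
  induction φ with
  | rel R args => simp [subst]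
  | eq σ M N => simp [subst, Term.subst_ids]
  | conn d φ ih => simp [subst, ih]
  | quant Ω σ φ ih => simp [subst, ih]

theorem subst_subst {Γ Δ Θ : Ctx Sg} (γ : Sub Γ Δ) (δ : Sub Δ Θ) (φ : Formula L Sg Θ) :
    (φ.subst δ).subst γ = φ.subst (γ.comp δ) := by
  induction φ generalizing Γ Δ with
  | rel R args => simp [subst, Sub.comp_assoc]
  | eq σ M N => simp [subst, Term.subst_subst]
  | conn d φ ih => simp [subst, ih]
  | quant Ω σ φ ih => simp [subst, ih, Sub.lift_comp]

theorem map_subst_ids (Φ : List (Formula L Sg Γ)) : Φ.map (subst (Sub.ids Γ)) = Φ := by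
  simp [subst_ids, List.map_id'']

theorem map_subst_subst (γ : Sub Γ Δ) (δ : Sub Δ Θ) (Φ : List (Formula L Sg Θ)) :
    (Φ.map (subst δ)).map (subst γ) = Φ.map (subst (γ.comp δ)) := by
  simp [subst_subst]

@[simp] theorem subst_e (γ : Sub Γ Δ) : (e : Formula L Sg Δ).subst γ = e := by
  simp only [e, subst]; congr; funext i; exact i.elim0

@[simp] theorem subst_tensor (γ : Sub Γ Δ) (φ ψ : Formula L Sg Δ) :
    (φ.tensor ψ).subst γ = (φ.subst γ).tensor (ψ.subst γ) := by
  simp only [tensor, subst]; congr; funext i; fin_cases i <;> rfl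

theorem subst_tensorList (γ : Sub Γ Δ) : ∀ Φ : List (Formula L Sg Δ),
    (tensorList Φ).subst γ = tensorList (Φ.map (subst γ))
  | [] => subst_e γ
  | [_] => rfl
  | _ :: ψ :: Φ => (subst_tensor γ _ _).trans
      (congrArg (tensor _) (subst_tensorList γ (ψ :: Φ)))

theorem subst_quants (Ω : L.Quant) (γ : Sub Γ Δ) : ∀ (Θ : Ctx Sg) (φ : Formula L Sg (Θ ++ Δ)),
    (φ.quants Ω Θ).subst γ = (φ.subst (γ.lifts Θ)).quants Ω Θ
  | [], _ => rfl
  | _ :: Θ, φ => subst_quants Ω γ Θ (.quant Ω _ φ)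

theorem subst_eqList (θ : Sub Ξ Γ) : ∀ (Δ : Ctx Sg) (γ δ : Sub Γ Δ),
    (eqList Δ γ δ).map (subst θ) = (eqList Δ (θ.comp γ) (θ.comp δ) : List (Formula L Sg Ξ))
  | [], _, _ => rfl
  | _ :: Δ, γ, δ => by
      simp only [eqList, List.map_append, List.map_cons, List.map_nil, subst_eqList θ Δ]; rfl

theorem eqList_append (Δ : Ctx Sg) : ∀ (Δ' : Ctx Sg) (γ δ : Sub Γ (Δ' ++ Δ)),
    (eqList (Δ' ++ Δ) γ δ : List (Formula L Sg Γ)) =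
      eqList Δ (fun _ v => γ (v.inLeft Δ')) (fun _ v => δ (v.inLeft Δ')) ++
        eqList Δ' (fun _ v => γ v.inRight) (fun _ v => δ v.inRight)
  | [], _, _ => (List.append_nil _).symm
  | _ :: Δ', γ, δ => by
      simp only [List.cons_append, eqList, ← List.append_assoc]
      exact congrArg (· ++ _) (eqList_append Δ Δ' _ _)

/-- The renaming only reassociates the context. It fixes the innermost variable, so each quantifier
over `Θ` can be peeled off; once `Θ` is exhausted the renaming is the identity. -/
theorem quants_append (Ω : L.Quant) (Γ Δ : Ctx Sg) : ∀ (Θ : Ctx Sg)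
    (φ : Formula L Sg (Θ ++ (Δ ++ Γ))),
    (φ.subst (Sub.ofRen fun _ v => Var.assoc Θ v)).quants Ω (Θ ++ Δ) =
      (φ.quants Ω Θ).quants Ω Δ
  | [], φ => congrArg (quants Ω Δ) φ.subst_ids
  | σ :: Θ, φ => by
      rw [Sub.ofRen_assoc_cons]
      exact quants_append Ω Γ Δ Θ (.quant Ω σ φ)

end Formula

end

/-! ## Derivability -/

namespace MinDerivable
open Assertion

variable {L : FOLang.{ℓ}} {Sg : Signature.{s}} {T : Theory L Sg} {Γ Δ Θ : Ctx Sg}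

/-- No weakening rule for equations is needed: substitute `M` and `M'` into the reflexivity `x = x
[Γ, x : τ]`, since the substitution rule already lets `Δ` be included in `Γ`. -/
theorem eqn_rename (ρ : Ren Γ Δ) (hρ : ∀ σ, Function.Injective (@ρ σ)) {τ : Sg.Sorts}
    {M M' : Term Sg Δ τ} (hM : MinDerivable T (eqn M M')) :
    MinDerivable T (eqn (M.subst (Sub.ofRen ρ)) (M'.subst (Sub.ofRen ρ))) :=
  eqSubst (Γ := Γ) (Γ' := []) ρ hρ hM (eqRefl (.var (.zero : Var (τ :: Γ) τ)))

theorem eqn_cast {τ : Sg.Sorts} {M M' : Term Sg Δ τ} (hM : MinDerivable T (eqn M M'))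
    (hΔ : Δ = Γ) : MinDerivable T (eqn (M.subst (Sub.ofRen fun _ v => hΔ ▸ v))
      (M'.subst (Sub.ofRen fun _ v => hΔ ▸ v))) := by
  subst hΔ
  simpa only [show (Sub.ofRen fun _ v => v : Sub Δ Δ) = Sub.ids Δ from rfl, Term.subst_ids] using hM

theorem seq_cast {Φ : List (Formula L Sg Δ)} {ψ : Formula L Sg Δ} (h : MinDerivable T (seq Φ ψ))
    (hΔ : Δ = Γ) : MinDerivable T (seq (Φ.map (Formula.subst (Sub.ofRen fun _ v => hΔ ▸ v)))
      (ψ.subst (Sub.ofRen fun _ v => hΔ ▸ v))) := by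
  subst hΔ
  simpa only [show (Sub.ofRen fun _ v => v : Sub Δ Δ) = Sub.ids Δ from rfl, Formula.subst_ids,
    Formula.map_subst_ids] using h

/-- Induction on `Δ`, one use of the substitution rule per variable. The terms live over the block
`Γ`, disjoint from `Δ`, so no substituted term is affected by the later substitutions. -/
theorem eqn_pair_ids : ∀ {Δ : Ctx Sg} {γ γ' : Sub Γ Δ},
    (∀ σ (v : Var Δ σ), MinDerivable T (eqn (γ v) (γ' v))) →
    ∀ {τ : Sg.Sorts} {M M' : Term Sg (Γ ++ Δ) τ}, MinDerivable T (eqn M M') →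
    MinDerivable T (eqn (M.subst (Sub.pair Γ γ (Sub.ids Γ)))
      (M'.subst (Sub.pair Γ γ' (Sub.ids Γ))))
  | [], γ, γ', _, _, _, _, hM => by
      rw [Sub.pair_nil_ids, Sub.pair_nil_ids]
      exact eqn_cast hM (List.append_nil Γ)
  | _ :: _, γ, γ', hγ, _, _, _, hM => by
      rw [Sub.pair_ids_eq_comp_inst, Sub.pair_ids_eq_comp_inst, ← Term.subst_subst,
        ← Term.subst_subst]
      exact eqn_pair_ids (fun σ v => hγ σ v.succ)
        (eqSubst _ (fun _ => Var.inRight_injective) (hγ _ .zero) hM)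

theorem seq_pair_ids : ∀ {Δ : Ctx Sg} {γ γ' : Sub Γ Δ},
    (∀ σ (v : Var Δ σ), MinDerivable T (eqn (γ v) (γ' v))) →
    ∀ {Φ : List (Formula L Sg (Γ ++ Δ))} {ψ : Formula L Sg (Γ ++ Δ)}, MinDerivable T (seq Φ ψ) →
    MinDerivable T (seq (Φ.map (Formula.subst (Sub.pair Γ γ (Sub.ids Γ))))
      (ψ.subst (Sub.pair Γ γ' (Sub.ids Γ))))
  | [], γ, γ', _, _, _, hΦ => by
      rw [Sub.pair_nil_ids, Sub.pair_nil_ids]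
      exact seq_cast hΦ (List.append_nil Γ)
  | _ :: _, γ, γ', hγ, _, _, hΦ => by
      rw [Sub.pair_ids_eq_comp_inst, Sub.pair_ids_eq_comp_inst, ← Formula.subst_subst,
        ← Formula.map_subst_subst]
      exact seq_pair_ids (fun σ v => hγ σ v.succ)
        (sub _ (fun _ => Var.inRight_injective) (hγ _ .zero) hΦ)

/-- Iterated context weakening. It adds variables only at the end, which is why the working context
is `[Δ, Γ]` rather than `[Γ, Δ]`. -/
theorem seq_weaken {Φ : List (Formula L Sg Δ)} {ψ : Formula L Sg Δ}
    (hΦ : MinDerivable T (seq Φ ψ)) : ∀ Γ : Ctx Sg, MinDerivable T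
      (seq (Φ.map (Formula.subst (Sub.projLeft Δ Γ))) (ψ.subst (Sub.projLeft Δ Γ)))
  | [] => by
      change MinDerivable T (seq (Γ := Δ) (Φ.map (Formula.subst (Sub.ids Δ)))
        (ψ.subst (Sub.ids Δ)))
      rwa [Formula.map_subst_ids, Formula.subst_ids]
  | σ :: Γ => by
      rw [Sub.projLeft_cons, ← Formula.map_subst_subst, ← Formula.subst_subst]
      exact cwk σ (seq_weaken hΦ Γ)

/-- Simultaneous substitution of provably equal terms in an equation. -/
theorem eqn_subst {γ γ' : Sub Γ Δ} (hγ : ∀ σ (v : Var Δ σ), MinDerivable T (eqn (γ v) (γ' v)))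
    {τ : Sg.Sorts} {M M' : Term Sg Δ τ} (hM : MinDerivable T (eqn M M')) :
    MinDerivable T (eqn (M.subst γ) (M'.subst γ')) := by
  have := eqn_pair_ids hγ
    (eqn_rename (Γ := Γ ++ Δ) (fun _ v => v.inLeft Γ) (fun _ => Var.inLeft_injective Γ) hM)
  rw [Term.subst_subst, Term.subst_subst] at this
  exact (Sub.pair_comp_projLeft γ (Sub.ids Γ)) ▸ (Sub.pair_comp_projLeft γ' (Sub.ids Γ)) ▸ this

/-- Simultaneous substitution of provably equal terms in a sequent. -/
theorem seq_subst {γ γ' : Sub Γ Δ} (hγ : ∀ σ (v : Var Δ σ), MinDerivable T (eqn (γ v) (γ' v)))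
    {Φ : List (Formula L Sg Δ)} {ψ : Formula L Sg Δ} (hΦ : MinDerivable T (seq Φ ψ)) :
    MinDerivable T (seq (Φ.map (Formula.subst γ)) (ψ.subst γ')) := by
  have := seq_pair_ids hγ (seq_weaken hΦ Γ)
  rwa [Formula.map_subst_subst, Formula.subst_subst, Sub.pair_comp_projLeft,
    Sub.pair_comp_projLeft] at this

/-- Unfold the tensor at its head and move that formula into the left context `Φ`; the induction
therefore needs arbitrary formulas on both sides. -/
theorem seq_tensorList_append (Φ Χ : List (Formula L Sg Γ)) {θ : Formula L Sg Γ} :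
    ∀ Ψ : List (Formula L Sg Γ),
      MinDerivable T (seq (Φ ++ Formula.tensorList Ψ :: Χ) θ) ↔
        MinDerivable T (seq (Φ ++ (Ψ ++ Χ)) θ)
  | [] => ⟨unitElim, unitIntro⟩
  | [_] => Iff.rfl
  | φ :: ψ :: Ψ => by
      have := seq_tensorList_append (Φ ++ [φ]) Χ (θ := θ) (ψ :: Ψ)
      simp only [List.append_assoc, List.cons_append, List.nil_append] at this
      exact Iff.trans ⟨tensorElim, tensorIntro⟩ this

theorem seq_tensorList {Φ : List (Formula L Sg Γ)} {θ : Formula L Sg Γ} :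
    MinDerivable T (seq [Formula.tensorList Φ] θ) ↔ MinDerivable T (seq Φ θ) := by
  simpa using seq_tensorList_append (T := T) [] [] (θ := θ) Φ

end MinDerivable

/-! ## The syntactic category -/

open Assertion

section
variable {L : FOLang.{ℓ}} {Sg : Signature.{s}} (T : Theory L Sg)

/-- Provable equality of lists of terms. -/
def subSetoid (Γ Δ : Ctx Sg) : Setoid (Sub Γ Δ) where
  r γ δ := ∀ σ (v : Var Δ σ), MinDerivable T (eqn (γ v) (δ v))
  iseqv :=
    { refl := fun _ _ _ => .eqRefl _
      symm := fun h σ v => .eqSymm (h σ v)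
      trans := fun h h' σ v => .eqTrans (h σ v) (h' σ v) }

variable {T} in
theorem subSetoid_append {Γ Δ Θ : Ctx Sg} {γ δ : Sub Θ (Δ ++ Γ)}
    (hl : subSetoid T Θ Γ (γ.comp (Sub.projLeft Γ Δ)) (δ.comp (Sub.projLeft Γ Δ)))
    (hr : subSetoid T Θ Δ (γ.comp (Sub.projRight Γ Δ)) (δ.comp (Sub.projRight Γ Δ))) :
    subSetoid T Θ (Δ ++ Γ) γ δ :=
  fun σ v => Var.append_cases (motive := fun v => MinDerivable T (eqn (γ v) (δ v)))
    (hl σ) (hr σ) v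

variable {T} in
theorem subSetoid_pair {Γ Δ Θ : Ctx Sg} {γ γ' : Sub Θ Γ} {δ δ' : Sub Θ Δ}
    (hγ : subSetoid T Θ Γ γ γ') (hδ : subSetoid T Θ Δ δ δ') :
    subSetoid T Θ (Δ ++ Γ) (Sub.pair Δ γ δ) (Sub.pair Δ γ' δ') :=
  subSetoid_append (by rwa [Sub.pair_comp_projLeft, Sub.pair_comp_projLeft])
    (by rwa [Sub.pair_comp_projRight, Sub.pair_comp_projRight])

/-- Interderivability of formulas. -/
def formSetoid (Γ : Ctx Sg) : Setoid (Formula L Sg Γ) where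
  r φ ψ := MinDerivable T (seq [φ] ψ) ∧ MinDerivable T (seq [ψ] φ)
  iseqv :=
    { refl := fun φ => ⟨.ax φ, .ax φ⟩
      symm := fun h => ⟨h.2, h.1⟩
      trans := fun h h' => ⟨.cut h.1 h'.1, .cut h'.2 h.2⟩ }

/-- The syntactic category of a theory; its objects are the contexts. -/
def SynCat (_ : Theory L Sg) : Type s := Ctx Sg

namespace SynCat

/-- A context as an object of the syntactic category. -/
abbrev of (Γ : Ctx Sg) : SynCat T := Γ

instance : Category.{s} (SynCat T) where
  Hom Γ Δ := Quotient (subSetoid T Γ Δ)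
  id Γ := Quotient.mk _ (Sub.ids Γ)
  comp := Quotient.map₂ Sub.comp fun _ _ hγ _ _ hδ σ v => .eqn_subst hγ (hδ σ v)
  id_comp f := Quotient.inductionOn f fun γ => congrArg (Quotient.mk _) (Sub.ids_comp γ)
  comp_id f := Quotient.inductionOn f fun γ => congrArg (Quotient.mk _) (Sub.comp_ids γ)
  assoc f g k := Quotient.inductionOn₃ f g k fun γ δ θ =>
    congrArg (Quotient.mk _) (Sub.comp_assoc γ δ θ)

/-- The morphism given by a list of terms. -/
def hom {Γ Δ : Ctx Sg} (γ : Sub Γ Δ) : of T Γ ⟶ of T Δ := Quotient.mk (subSetoid T Γ Δ) γ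

variable {T} {Γ Δ Θ : Ctx Sg}

theorem hom_surjective : Function.Surjective (hom T : Sub Γ Δ → (of T Γ ⟶ of T Δ)) :=
  Quotient.mk_surjective

theorem hom_eq_iff {γ δ : Sub Γ Δ} :
    hom T γ = hom T δ ↔ ∀ σ (v : Var Δ σ), MinDerivable T (eqn (γ v) (δ v)) :=
  Quotient.eq (r := subSetoid T Γ Δ)

variable (T) in
/-- The empty context is terminal. -/
def terminalCone : Limits.LimitCone (Functor.empty.{0} (SynCat T)) where
  cone := Limits.asEmptyCone (of T [])
  isLimit := Limits.IsTerminal.ofUniqueHom (fun _ => hom T fun _ v => nomatch v) fun _ f => by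
    obtain ⟨γ, rfl⟩ := hom_surjective f
    exact hom_eq_iff.2 fun _ v => nomatch v

variable (T) in
/-- Concatenation of contexts is a product. -/
def productCone (Γ Δ : Ctx Sg) : Limits.LimitCone (Limits.pair (of T Γ) (of T Δ)) where
  cone := Limits.BinaryFan.mk (P := of T (Δ ++ Γ)) (hom T (Sub.projLeft Γ Δ))
    (hom T (Sub.projRight Γ Δ))
  isLimit := Limits.BinaryFan.IsLimit.mk _
    (fun {Θ} f g => Quotient.map₂ (sa := subSetoid T Θ Γ) (sb := subSetoid T Θ Δ)
      (sc := subSetoid T Θ (Δ ++ Γ)) (Sub.pair Δ)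
      (fun _ _ hγ _ _ hδ => subSetoid_pair hγ hδ) f g)
    (fun f g => Quotient.inductionOn₂ f g fun γ δ =>
      congrArg (hom T) (Sub.pair_comp_projLeft γ δ))
    (fun f g => Quotient.inductionOn₂ f g fun γ δ =>
      congrArg (hom T) (Sub.pair_comp_projRight γ δ))
    (fun f g m => Quotient.inductionOn₃ f g m fun γ δ _ hf hg => hom_eq_iff.2 <| subSetoid_append
      (hom_eq_iff.1 (hf.trans (congrArg (hom T) (Sub.pair_comp_projLeft γ δ)).symm))
      (hom_eq_iff.1 (hg.trans (congrArg (hom T) (Sub.pair_comp_projRight γ δ)).symm)))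

/-- With these chosen cones, product and unit are by definition concatenation and the empty context,
as the later definitional steps require. -/
instance : CartesianMonoidalCategory (SynCat T) :=
  .ofChosenFiniteProducts (terminalCone T) (productCone T)

theorem lift_hom (γ : Sub Θ Γ) (δ : Sub Θ Δ) :
    lift (hom T γ) (hom T δ) = hom T (Sub.pair Δ γ δ) := by
  refine CartesianMonoidalCategory.hom_ext (X := of T Γ) (Y := of T Δ) _ _ ?_ ?_
  · exact (lift_fst _ _).trans (congrArg (hom T) (Sub.pair_comp_projLeft γ δ)).symm
  · exact (lift_snd _ _).trans (congrArg (hom T) (Sub.pair_comp_projRight γ δ)).symm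

theorem hom_whiskerRight (γ : Sub Γ Δ) :
    hom T γ ▷ of T Θ = hom T (γ.lifts Θ) := by
  refine CartesianMonoidalCategory.hom_ext (X := of T Δ) (Y := of T Θ) _ _ ?_ ?_
  · exact (whiskerRight_fst _ _).trans (congrArg (hom T) (Sub.lifts_comp_projLeft γ Θ)).symm
  · exact (whiskerRight_snd _ _).trans (congrArg (hom T) (Sub.lifts_comp_projRight γ Θ)).symm

/-- Morphisms into a product are determined by their projections. Concatenation is associative only
propositionally, so the associator is a renaming and not an identity. -/
theorem associator_inv_eq :
    (α_ (of T Γ) (of T Δ) (of T Θ)).inv =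
      hom T (Sub.ofRen fun _ v => Var.assoc Θ v : Sub ((Θ ++ Δ) ++ Γ) (Θ ++ (Δ ++ Γ))) := by
  refine CartesianMonoidalCategory.hom_ext (X := of T Γ ⊗ of T Δ) (Y := of T Θ) _ _
    (CartesianMonoidalCategory.hom_ext (X := of T Γ) (Y := of T Δ) _ _ ?_ ?_) ?_
  · rw [Category.assoc, associator_inv_fst_fst]
    exact congrArg (hom T) (funext fun _ => funext fun v =>
      congrArg Term.var (Var.assoc_inLeft_inLeft v Θ).symm)
  · rw [Category.assoc, associator_inv_fst_snd]
    exact congrArg (hom T) (funext fun _ => funext fun v =>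
      congrArg Term.var (Var.assoc_inLeft_inRight v Θ).symm)
  · rw [associator_inv_snd]
    exact congrArg (hom T) (funext fun _ => funext fun v =>
      congrArg Term.var (Var.assoc_inRight v).symm)

end SynCat

end

/-! ### The posets of formulas and the syntactic prop-category -/

section
variable {L : FOLang.{ℓ}} {Sg : Signature.{s}} (T : Theory L Sg)

/-- The formulas in context `Γ` modulo interderivability. -/
def FormClass (Γ : Ctx Sg) : Type (max ℓ s) := Quotient (formSetoid T Γ)

namespace FormClass

/-- The class of a formula. -/
def cls {Γ : Ctx Sg} (φ : Formula L Sg Γ) : FormClass T Γ := Quotient.mk _ φ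

variable {T} {Γ Δ Θ : Ctx Sg}

theorem cls_surjective : Function.Surjective (cls T : Formula L Sg Γ → FormClass T Γ) :=
  Quotient.mk_surjective

theorem cls_eq_iff {φ ψ : Formula L Sg Γ} :
    cls T φ = cls T ψ ↔ MinDerivable T (seq [φ] ψ) ∧ MinDerivable T (seq [ψ] φ) :=
  Quotient.eq (r := formSetoid T Γ)

/-- A Yoneda argument: test each formula's consequences on the other formula. -/
theorem cls_eq_of_forall {φ ψ : Formula L Sg Γ}
    (hφ : ∀ θ, MinDerivable T (seq [φ] θ) ↔ MinDerivable T (seq [ψ] θ)) : cls T φ = cls T ψ :=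
  cls_eq_iff.2 ⟨(hφ ψ).2 (.ax ψ), (hφ φ).1 (.ax φ)⟩

instance partialOrder : PartialOrder (FormClass T Γ) where
  le := Quotient.lift₂ (fun φ ψ => MinDerivable T (seq [φ] ψ)) fun _ _ _ _ hφ hψ =>
    propext ⟨fun h => .cut hφ.2 (.cut h hψ.1), fun h => .cut hφ.1 (.cut h hψ.2)⟩
  le_refl x := Quotient.inductionOn x .ax
  le_trans x y z := Quotient.inductionOn₃ x y z fun _ _ _ => .cut
  le_antisymm x y := Quotient.inductionOn₂ x y fun _ _ h h' => cls_eq_iff.2 ⟨h, h'⟩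

theorem cls_le_iff {φ ψ : Formula L Sg Γ} : cls T φ ≤ cls T ψ ↔ MinDerivable T (seq [φ] ψ) :=
  Iff.rfl

/-- The action of morphisms on classes of formulas, by simultaneous substitution. -/
def pull (f : SynCat.of T Γ ⟶ SynCat.of T Δ) : FormClass T Δ →o FormClass T Γ where
  -- Independence of the representing terms uses substitution of different, provably equal terms on
  -- the two sides of a sequent.
  toFun := Quotient.map₂ Formula.subst (fun _ _ hγ _ _ hφ =>
    ⟨.seq_subst hγ hφ.1, .seq_subst ((subSetoid T Γ Δ).symm hγ) hφ.2⟩) f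
  monotone' := Quotient.inductionOn f fun _ x y => Quotient.inductionOn₂ x y fun _ _ =>
    .seq_subst fun _ _ => .eqRefl _

/-- The operation of a connective on classes of formulas. -/
noncomputable def conn {n : ℕ} (d : L.Conn n) (q : Fin n → FormClass T Γ) : FormClass T Γ :=
  cls T (.conn d fun i => (q i).out)

theorem conn_cls {n : ℕ} (d : L.Conn n) (φ : Fin n → Formula L Sg Γ) :
    conn d (fun i => cls T (φ i)) = cls T (.conn d φ) :=
  have h i := cls_eq_iff.1 (Quotient.out_eq (cls T (φ i)))
  cls_eq_iff.2 ⟨.connCong d (fun i => (h i).1) fun i => (h i).2,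
    .connCong d (fun i => (h i).2) fun i => (h i).1⟩

theorem exists_cls {n : ℕ} (q : Fin n → FormClass T Γ) :
    ∃ φ : Fin n → Formula L Sg Γ, q = fun i => cls T (φ i) :=
  ⟨fun i => (q i).out, funext fun i => (Quotient.out_eq (q i)).symm⟩

theorem conn_e : conn L.e ![] = cls T (Formula.e : Formula L Sg Γ) :=
  (congrArg (conn L.e) (Subsingleton.elim _ _)).trans (conn_cls L.e ![])

theorem conn_tensor (φ ψ : Formula L Sg Γ) :
    conn L.tensor ![cls T φ, cls T ψ] = cls T (φ.tensor ψ) := by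
  refine Eq.trans (congrArg (conn L.tensor) ?_) (conn_cls L.tensor ![φ, ψ])
  funext i; fin_cases i <;> rfl

/-- Either bracketing entails `χ` exactly when the sequent `φ, ψ, θ ⊢ χ` is derivable, by the
two-way rule for `⊗`. -/
theorem cls_tensor_assoc (φ ψ θ : Formula L Sg Γ) :
    cls T ((φ.tensor ψ).tensor θ) = cls T (φ.tensor (ψ.tensor θ)) :=
  cls_eq_of_forall fun χ => by
    refine Iff.trans (b := MinDerivable T (seq [φ, ψ, θ] χ)) ⟨fun h => ?_, fun h => ?_⟩
      ⟨fun h => ?_, fun h => ?_⟩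
    · exact .tensorElim (Φ := []) (.tensorElim (Φ := []) h)
    · exact .tensorIntro (Φ := []) (.tensorIntro (Φ := []) h)
    · exact .tensorIntro (Φ := []) (.tensorIntro (Φ := [φ]) h)
    · exact .tensorElim (Φ := [φ]) (.tensorElim (Φ := []) h)

theorem cls_e_tensor (φ : Formula L Sg Γ) : cls T (Formula.e.tensor φ) = cls T φ :=
  cls_eq_of_forall fun _ => ⟨fun h => .unitElim (Φ := []) (.tensorElim (Φ := []) h),
    fun h => .tensorIntro (Φ := []) (.unitIntro (Φ := []) h)⟩

theorem cls_tensor_e (φ : Formula L Sg Γ) : cls T (φ.tensor .e) = cls T φ :=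
  cls_eq_of_forall fun _ => ⟨fun h => .unitElim (Φ := [φ]) (.tensorElim (Φ := []) h),
    fun h => .tensorIntro (Φ := []) (.unitIntro (Φ := [φ]) h)⟩

theorem conn_tensor_assoc (x y z : FormClass T Γ) :
    conn L.tensor ![conn L.tensor ![x, y], z] = conn L.tensor ![x, conn L.tensor ![y, z]] := by
  obtain ⟨φ, rfl⟩ := cls_surjective x
  obtain ⟨ψ, rfl⟩ := cls_surjective y
  obtain ⟨θ, rfl⟩ := cls_surjective z
  simp only [conn_tensor, cls_tensor_assoc]

theorem conn_e_tensor (x : FormClass T Γ) : conn L.tensor ![conn L.e ![], x] = x := by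
  obtain ⟨φ, rfl⟩ := cls_surjective x
  simp only [conn_e, conn_tensor, cls_e_tensor]

theorem conn_tensor_e (x : FormClass T Γ) : conn L.tensor ![x, conn L.e ![]] = x := by
  obtain ⟨φ, rfl⟩ := cls_surjective x
  simp only [conn_e, conn_tensor, cls_tensor_e]

/-- Both sides have the consequences of the list `Φ ++ Ψ`. The formulas themselves may differ in
bracketing and in factors `e`. -/
theorem cls_tensorList_append (Φ Ψ : List (Formula L Sg Γ)) :
    cls T (Formula.tensorList (Φ ++ Ψ)) =
      cls T ((Formula.tensorList Φ).tensor (Formula.tensorList Ψ)) :=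
  cls_eq_of_forall fun θ => by
    rw [MinDerivable.seq_tensorList]
    refine Iff.trans ?_ ⟨fun h => .tensorIntro (Φ := []) h, fun h => .tensorElim (Φ := []) h⟩
    have h := MinDerivable.seq_tensorList_append (T := T) Φ [] (θ := θ) Ψ
    rw [List.append_nil] at h
    exact h.symm.trans (MinDerivable.seq_tensorList_append [] [_] Φ).symm

theorem quants_congr (Ω : L.Quant) : ∀ (Δ : Ctx Sg) {φ ψ : Formula L Sg (Δ ++ Γ)},
    cls T φ = cls T ψ → cls T (φ.quants Ω Δ) = cls T (ψ.quants Ω Δ)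
  | [], _, _, h => h
  | _ :: Δ, _, _, h =>
    have h := cls_eq_iff.1 h
    quants_congr Ω Δ (cls_eq_iff.2 ⟨.quantCong Ω h.1 h.2, .quantCong Ω h.2 h.1⟩)

/-- The operation of a quantifier on classes of formulas. -/
def quants (Ω : L.Quant) (Δ : Ctx Sg) : FormClass T (Δ ++ Γ) → FormClass T Γ :=
  Quotient.lift (fun φ => cls T (φ.quants Ω Δ)) fun _ _ h =>
    quants_congr Ω Δ (Quotient.sound h)

end FormClass

open FormClass

/-- The poset of formulas modulo interderivability. -/
def formPoset (Γ : Ctx Sg) : PartOrd.{max ℓ s} := .of (FormClass T Γ)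

/-- The action of a morphism on formulas modulo interderivability. -/
def formMap {Γ Δ : Ctx Sg} (f : SynCat.of T Γ ⟶ SynCat.of T Δ) : formPoset T Δ ⟶ formPoset T Γ :=
  PartOrd.ofHom (pull f)

theorem formMap_comp {Γ Δ Θ : Ctx Sg} (f : SynCat.of T Γ ⟶ SynCat.of T Δ)
    (g : SynCat.of T Δ ⟶ SynCat.of T Θ) : formMap T (f ≫ g) = formMap T g ≫ formMap T f :=
  PartOrd.ext fun x => Quotient.inductionOn₃ f g x fun γ δ φ =>
    congrArg (cls T) (φ.subst_subst γ δ).symm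

/-- The functor of formulas modulo interderivability. -/
def formFunctor : (SynCat T)ᵒᵖ ⥤ PartOrd.{max ℓ s} where
  obj Γ := formPoset T Γ.unop
  map f := formMap T f.unop
  map_id _ := PartOrd.ext fun x => Quotient.inductionOn x fun φ => congrArg (cls T) φ.subst_ids
  map_comp f g := formMap_comp T g.unop f.unop

theorem Formula.subst_eqCtx {Γ Δ : Ctx Sg} (θ : Sub Δ (Γ ++ Γ)) :
    (eqCtx Γ : Formula L Sg _).subst θ = tensorList (eqList Γ (θ.comp (Sub.projLeft Γ Γ))
      (θ.comp (Sub.projRight Γ Γ))) := by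
  rw [eqCtx, subst_tensorList, subst_eqList]

variable {T} in
theorem FormClass.cls_eqCtx_append (Γ Δ : Ctx Sg) : cls T (Formula.eqCtx (Δ ++ Γ)) =
    conn L.tensor
      ![cls T ((Formula.eqCtx Γ).subst
          (Sub.pair Γ ((Sub.projLeft (Δ ++ Γ) (Δ ++ Γ)).comp (Sub.projLeft Γ Δ))
            ((Sub.projRight (Δ ++ Γ) (Δ ++ Γ)).comp (Sub.projLeft Γ Δ)))),
        cls T ((Formula.eqCtx Δ).subst
          (Sub.pair Δ ((Sub.projLeft (Δ ++ Γ) (Δ ++ Γ)).comp (Sub.projRight Γ Δ))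
            ((Sub.projRight (Δ ++ Γ) (Δ ++ Γ)).comp (Sub.projRight Γ Δ))))] := by
  rw [conn_tensor, Formula.subst_eqCtx, Formula.subst_eqCtx, ← cls_tensorList_append]
  simp only [Sub.pair_comp_projLeft, Sub.pair_comp_projRight]
  exact congrArg (fun Φ => cls T (Formula.tensorList Φ)) (Formula.eqList_append Γ Δ _ _)

/-- The classifying prop-category of a theory. -/
noncomputable def classifyingFA : FA.{ℓ, s, s, max ℓ s} L where
  C := SynCat T
  P := formFunctor T
  conn Γ _ d q := conn (T := T) (Γ := Γ) d q
  conn_natural {Γ Δ} f n d q := by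
    obtain ⟨γ, rfl⟩ := SynCat.hom_surjective (T := T) f
    obtain ⟨φ, rfl⟩ := exists_cls (T := T) q
    exact (congrArg (pull (SynCat.hom T γ)) (conn_cls d φ)).trans
      (conn_cls d fun i => (φ i).subst γ).symm
  Eq Γ := cls T (Formula.eqCtx Γ)
  quant Ω Γ Δ q := quants (T := T) (Γ := Γ) Ω Δ q
  quant_natural Ω {Γ Δ} f Θ q := by
    obtain ⟨γ, rfl⟩ := SynCat.hom_surjective (T := T) f
    obtain ⟨φ, rfl⟩ := cls_surjective (T := T) q
    refine (congrArg (cls T) (Formula.subst_quants Ω γ Θ φ)).trans ?_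
    exact congrArg (fun k => quants Ω Θ (pull k (cls T φ))) (SynCat.hom_whiskerRight (T := T) γ).symm
  tensor_assoc _ := conn_tensor_assoc
  unit_tensor _ := conn_e_tensor
  tensor_unit _ := conn_tensor_e
  quant_one Ω Γ q := by
    obtain ⟨φ, rfl⟩ := cls_surjective (T := T) q
    -- Appending the empty context changes nothing definitionally, and the projection is the list of
    -- variables.
    exact congrArg (cls T) φ.subst_ids
  quant_prod Ω := fun (Γ Δ Θ : Ctx Sg) q => by
    obtain ⟨φ, rfl⟩ := cls_surjective (T := T) q
    refine (congrArg (fun k => quants Ω (Θ ++ Δ) (pull k (cls T φ)))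
      (SynCat.associator_inv_eq (T := T))).trans ?_
    exact congrArg (cls T) (Formula.quants_append Ω Γ Δ Θ φ)
  Eq_one := conn_e.symm
  Eq_prod := fun (Γ Δ : Ctx Sg) => by
    refine Eq.trans ?_ (congrArg₂ (fun k k' => conn L.tensor
      ![pull k (cls T (Formula.eqCtx Γ)), pull k' (cls T (Formula.eqCtx Δ))])
      (SynCat.lift_hom ((Sub.projLeft (Δ ++ Γ) (Δ ++ Γ)).comp (Sub.projLeft Γ Δ))
        ((Sub.projRight (Δ ++ Γ) (Δ ++ Γ)).comp (Sub.projLeft Γ Δ))).symm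
      (SynCat.lift_hom ((Sub.projLeft (Δ ++ Γ) (Δ ++ Γ)).comp (Sub.projRight Γ Δ))
        ((Sub.projRight (Δ ++ Γ) (Δ ++ Γ)).comp (Sub.projRight Γ Δ))).symm)
    exact cls_eqCtx_append Γ Δ

end

/-! ### Reindexing in an arbitrary prop-category -/

namespace FA

variable {L : FOLang.{ℓ}} (X : FA.{ℓ, o, h, p} L)

theorem pull_comp {b c d : X.C} (f : b ⟶ c) (g : c ⟶ d) (q : X.Pr d) :
    X.pull (f ≫ g) q = X.pull f (X.pull g q) :=
  ConcreteCategory.congr_hom (X.P.map_comp g.op f.op) q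

theorem pull_id {c : X.C} (q : X.Pr c) : X.pull (𝟙 c) q = q :=
  ConcreteCategory.congr_hom (X.P.map_id (op c)) q

theorem pull_eqToHom_le_iff {b c : X.C} (hbc : b = c) {q r : X.Pr c} :
    X.pull (eqToHom hbc) q ≤ X.pull (eqToHom hbc) r ↔ q ≤ r := by
  subst hbc
  rw [eqToHom_refl, pull_id, pull_id]

theorem pull_tensor {b c : X.C} (f : b ⟶ c) (q r : X.Pr c) :
    X.pull f (X.conn c L.tensor ![q, r]) = X.conn b L.tensor ![X.pull f q, X.pull f r] :=
  (X.conn_natural f L.tensor _).trans <| congrArg _ <| by funext i; fin_cases i <;> rfl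

theorem pull_e {b c : X.C} (f : b ⟶ c) : X.pull f (X.conn c L.e ![]) = X.conn b L.e ![] :=
  (X.conn_natural f L.e _).trans (congrArg _ (Subsingleton.elim _ _))

theorem pull_tensorList {b c : X.C} (f : b ⟶ c) : ∀ qs : List (X.Pr c),
    X.pull f (X.tensorList c qs) = X.tensorList b (qs.map (X.pull f))
  | [] => X.pull_e f
  | q :: qs => (X.pull_tensor f q _).trans
      (congrArg (fun r => X.conn b L.tensor ![X.pull f q, r]) (pull_tensorList f qs))

end FA

/-! ### The syntactic prop-category of a closed theory -/

section
variable {L : FOLang.{ℓ}} {Sg : Signature.{s}} {T : Theory L Sg}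

/-- The prop-category `classifyingFA T` is the classifying prop-category of a theory `T` that is
closed under the rules of the minimal logic. -/
noncomputable def classifying (hT : ∀ a, MinDerivable T a → a ∈ T) :
    Classifying T (classifyingFA T) where
  obj := Equiv.refl _
  hom := SynCat.hom T
  hom_surjective _ _ := SynCat.hom_surjective
  -- The quotient was taken by derivability from `T`; closure of `T` replaces this by membership.
  hom_eq_iff _ _ := SynCat.hom_eq_iff.trans
    ⟨fun h σ v => hT _ (h σ v), fun h σ v => .hyp (h σ v)⟩
  hom_id _ := rfl
  hom_comp _ _ := rfl
  obj_nil := rfl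
  obj_append _ _ := rfl
  proj_left _ _ := Category.id_comp _
  proj_right _ _ := Category.id_comp _
  cls := FormClass.cls T
  cls_surjective _ := FormClass.cls_surjective
  cls_le_iff _ _ := FormClass.cls_le_iff.trans ⟨hT _, .hyp⟩
  pull_cls _ _ := rfl
  conn_cls := FormClass.conn_cls
  quant_cls Ω Γ Γ' φ := congrArg (FormClass.quants (T := T) (Γ := Γ) Ω Γ')
    ((classifyingFA T).pull_id (c := SynCat.of T (Γ' ++ Γ)) (FormClass.cls T φ))
  Eq_cls Γ := ((classifyingFA T).pull_id (c := SynCat.of T (Γ ++ Γ))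
    (FormClass.cls T (Formula.eqCtx Γ))).symm

end

/-! ### Composition and projections along equalities of objects -/

section
variable {C : Type o} [Category.{h} C] {A B : C}

theorem comp_eq_of_eq {D F G : C} {k : A ⟶ B} {f : B ⟶ D} {g : D ⟶ F} {fg : B ⟶ F} {f' : D ⟶ G}
    {r : G ⟶ F} (hfg : f ≫ g = fg) (hr : f' ≫ r = g) : k ≫ fg = ((k ≫ f) ≫ f') ≫ r := by
  simp [← hfg, hr]

theorem comp_comp_eq_of_eq {D F G H : C} {k : A ⟶ B} {f : B ⟶ D} {g : D ⟶ F} {fg : B ⟶ F}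
    {l : F ⟶ H} {f' : D ⟶ G} {r : G ⟶ H} (hfg : f ≫ g = fg) (hr : f' ≫ r = g ≫ l) :
    (k ≫ fg) ≫ l = ((k ≫ f) ≫ f') ≫ r := by
  simp [← hfg, hr]

end

section
variable {C : Type o} [Category.{h} C] [CartesianMonoidalCategory C] {A A' B E : C}

/-- A context is only propositionally equal to the product of its sorts. Stating the coherence for
variable objects allows the equalities to be eliminated. -/
theorem eqToHom_comp_eqToHom_comp_fst (hA : A = A') (hE : A ⊗ B = E) (hE' : E = A' ⊗ B) :
    eqToHom hE ≫ eqToHom hE' ≫ fst A' B = fst A B ≫ eqToHom hA := by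
  subst hA; subst hE; simp

theorem eqToHom_comp_eqToHom_comp_snd (hA : A = A') (hE : A ⊗ B = E) (hE' : E = A' ⊗ B) :
    eqToHom hE ≫ eqToHom hE' ≫ snd A' B = snd A B := by
  subst hA; subst hE; simp

theorem eqToHom_symm_comp_fst (hA : A = A') (hE : A ⊗ B = E) (hE' : E = A' ⊗ B) :
    eqToHom hE.symm ≫ fst A B = (eqToHom hE' ≫ fst A' B) ≫ eqToHom hA.symm := by
  subst hA; subst hE; simp

theorem eqToHom_symm_comp_snd (hA : A = A') (hE : A ⊗ B = E) (hE' : E = A' ⊗ B) :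
    eqToHom hE.symm ≫ snd A B = eqToHom hE' ≫ snd A' B := by
  subst hA; subst hE; simp

theorem snd_eq_of_eqToHom_comp_snd (hA : A = A') (hE : E = A' ⊗ B) (hB : E = B)
    (h : eqToHom hE ≫ snd A' B = eqToHom hB) :
    snd A B = eqToHom hA ▷ B ≫ eqToHom hE.symm ≫ eqToHom hB := by
  subst hA; subst hE
  simpa using h

end

/-! ### The generic structure -/

namespace Classifying

variable {L : FOLang.{ℓ}} {Sg : Signature.{s}} {T : Theory L Sg} {X : FA.{ℓ, o, h, p} L}
  (K : Classifying T X) {Γ Δ Θ : Ctx Sg}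

theorem eqToHom_cons_comp_projLeft (σ τ : Sg.Sorts) (Γ : Ctx Sg) :
    eqToHom (K.ctxObj_eq (σ :: τ :: Γ)) ≫ K.hom (Sub.projLeft (τ :: Γ) [σ]) =
      fst _ _ ≫ eqToHom (K.ctxObj_eq (τ :: Γ)) :=
  (congrArg (eqToHom (K.ctxObj_eq (σ :: τ :: Γ)) ≫ ·) (K.proj_left (τ :: Γ) [σ]).symm).trans
    (eqToHom_comp_eqToHom_comp_fst (K.ctxObj_eq (τ :: Γ)) (K.ctxObj_eq (σ :: τ :: Γ)) _)

theorem eqToHom_cons_comp_projRight (σ τ : Sg.Sorts) (Γ : Ctx Sg) :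
    eqToHom (K.ctxObj_eq (σ :: τ :: Γ)) ≫ K.hom (Sub.projRight (τ :: Γ) [σ]) = snd _ _ :=
  (congrArg (eqToHom (K.ctxObj_eq (σ :: τ :: Γ)) ≫ ·) (K.proj_right (τ :: Γ) [σ]).symm).trans
    (eqToHom_comp_eqToHom_comp_snd (K.ctxObj_eq (τ :: Γ)) (K.ctxObj_eq (σ :: τ :: Γ)) _)

theorem ctxProj_eq : ∀ {Γ : Ctx Sg} {σ : Sg.Sorts} (v : Var Γ σ),
    ctxProj (fun σ => K.obj [σ]) v =
      eqToHom (K.ctxObj_eq Γ) ≫ K.hom (Sub.single (.var v))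
  | [σ], _, .zero => by
      rw [show Sub.single (.var .zero) = Sub.ids [σ] from Sub.single_zero (Sub.ids [σ]), K.hom_id]
      exact (Category.comp_id _).symm
  | σ :: τ :: Γ, _, .zero => (K.eqToHom_cons_comp_projRight σ τ Γ).symm.trans
      (congrArg (fun γ => _ ≫ K.hom γ) (Sub.single_zero (Sub.projRight (τ :: Γ) [σ])).symm)
  | σ :: τ :: Γ, ρ, .succ v => by
      have h := K.hom_comp (Sub.projLeft (τ :: Γ) [σ]) (Sub.single (.var v))
      rw [Sub.comp_single] at h
      exact (congrArg (fst _ _ ≫ ·) (ctxProj_eq v)).trans <| (Category.assoc _ _ _).symm.trans <|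
        (congrArg (· ≫ K.hom (Sub.single (.var v)))
          (K.eqToHom_cons_comp_projLeft σ τ Γ).symm).trans <|
        (Category.assoc _ _ _).trans (congrArg (eqToHom (K.ctxObj_eq (σ :: τ :: Γ)) ≫ ·) h)

theorem ctxTuple_eq (γ : Sub Γ Δ) :
    ctxTuple (fun σ => K.obj [σ]) Δ
        (fun _ v => eqToHom (K.ctxObj_eq Γ) ≫ K.hom (Sub.single (γ v))) ≫
      eqToHom (K.ctxObj_eq Δ) = eqToHom (K.ctxObj_eq Γ) ≫ K.hom γ := by
  -- Moving the comparison isomorphism to the right makes both sides morphisms into the product of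
  -- the sorts, where projections can be compared.
  rw [← cancel_mono (eqToHom (K.ctxObj_eq Δ).symm), Category.assoc, eqToHom_trans, eqToHom_refl,
    Category.comp_id]
  induction Δ with
  | nil => exact toUnit_unique _ _
  | cons σ Δ ih =>
    cases Δ with
    | nil =>
      change _ ≫ K.hom (Sub.single (γ .zero)) = _
      rw [Sub.single_zero]
      exact (Category.comp_id _).symm
    | cons τ Δ =>
      have hl : eqToHom (K.ctxObj_eq (σ :: τ :: Δ)).symm ≫ fst _ _ =
          K.hom (Sub.projLeft (τ :: Δ) [σ]) ≫ eqToHom (K.ctxObj_eq (τ :: Δ)).symm :=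
        (eqToHom_symm_comp_fst (K.ctxObj_eq (τ :: Δ)) (K.ctxObj_eq (σ :: τ :: Δ))
          (K.obj_append (τ :: Δ) [σ])).trans (congrArg (· ≫ _) (K.proj_left (τ :: Δ) [σ]))
      have hr : eqToHom (K.ctxObj_eq (σ :: τ :: Δ)).symm ≫ snd _ _ =
          K.hom (Sub.projRight (τ :: Δ) [σ]) :=
        (eqToHom_symm_comp_snd (K.ctxObj_eq (τ :: Δ)) (K.ctxObj_eq (σ :: τ :: Δ))
          (K.obj_append (τ :: Δ) [σ])).trans (K.proj_right (τ :: Δ) [σ])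
      refine CartesianMonoidalCategory.hom_ext (X := ctxObj (fun σ => K.obj [σ]) (τ :: Δ))
        (Y := K.obj [σ]) _ _ ?_ ?_
      · exact (lift_fst _ _).trans <| (ih fun _ v => γ v.succ).trans <|
          comp_comp_eq_of_eq (K.hom_comp γ (Sub.projLeft (τ :: Δ) [σ])) hl
      · exact (lift_snd _ _).trans <| comp_eq_of_eq ((K.hom_comp γ
          (Sub.projRight (τ :: Δ) [σ])).trans (congrArg K.hom (Sub.single_zero _).symm)) hr

theorem generic_term {τ : Sg.Sorts} (M : Term Sg Γ τ) :
    K.generic.term M = eqToHom (K.ctxObj_eq Γ) ≫ K.hom (Sub.single M) := by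
  induction M with
  | var v => exact K.ctxProj_eq v
  | app f args ih =>
    have h : K.generic.term (.app f args) = ctxTuple (fun σ => K.obj [σ]) (Sg.fnDom f)
        (fun _ v => eqToHom (K.ctxObj_eq Γ) ≫ K.hom (Sub.single (args v))) ≫ K.generic.fn f :=
      congrArg (fun a => ctxTuple (fun σ => K.obj [σ]) (Sg.fnDom f) a ≫ K.generic.fn f)
        (funext fun _ => funext fun v => ih v)
    rw [h]
    refine (Category.assoc _ _ _).symm.trans <| (congrArg (· ≫ K.hom _) (K.ctxTuple_eq args)).trans <|
      (Category.assoc _ _ _).trans (congrArg (eqToHom (K.ctxObj_eq Γ) ≫ ·) ?_)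
    -- Composing with the class of `f(x₁, …, xₙ)` substitutes the arguments for its variables.
    rw [K.hom_comp, Sub.comp_single]
    rfl

theorem generic_terms (γ : Sub Γ Δ) :
    K.generic.terms γ ≫ eqToHom (K.ctxObj_eq Δ) = eqToHom (K.ctxObj_eq Γ) ≫ K.hom γ :=
  (congrArg (fun a => ctxTuple (fun σ => K.obj [σ]) Δ a ≫ eqToHom (K.ctxObj_eq Δ))
    (funext fun _ => funext fun v => K.generic_term (γ v))).trans (K.ctxTuple_eq γ)

theorem lift_hom (γ : Sub Γ Δ) (δ : Sub Γ Θ) :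
    lift (K.hom γ) (K.hom δ) = K.hom (Sub.pair Θ γ δ) ≫ eqToHom (K.obj_append Δ Θ) := by
  refine CartesianMonoidalCategory.hom_ext _ _ ?_ ?_
  · rw [lift_fst, Category.assoc, K.proj_left, K.hom_comp, Sub.pair_comp_projLeft]
  · rw [lift_snd, Category.assoc, K.proj_right, K.hom_comp, Sub.pair_comp_projRight]

/-- The empty context is separate because the product of a single sort is that sort itself and not
`1 × σ`. -/
theorem ctxExt_comp_eqToHom (σ : Sg.Sorts) : ∀ Γ : Ctx Sg,
    ctxExt (fun σ => K.obj [σ]) σ Γ ≫ eqToHom (K.ctxObj_eq (σ :: Γ)) =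
      eqToHom (K.ctxObj_eq Γ) ▷ K.obj [σ] ≫ eqToHom (K.obj_append Γ [σ]).symm
  | [] => by
      have h := K.proj_right [] [σ]
      rw [show Sub.projRight [] [σ] = Sub.ids [σ] from Sub.cons_ext rfl fun _ v => nomatch v] at h
      replace h := h.trans (K.hom_id [σ])
      exact (Category.comp_id _).trans <| (snd_eq_of_eqToHom_comp_snd (K.ctxObj_eq [])
        (K.obj_append [] [σ]) rfl h).trans (congrArg (_ ≫ ·) (Category.comp_id _))
  | _ :: _ => by
      rw [eqToHom_whiskerRight, eqToHom_trans]
      exact Category.id_comp _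

/-- For a one-variable context the equality predicate is the class of the single equation `x = x'`,
into which `M` and `N` are substituted. -/
theorem pull_lift_Eq {b : X.C} (f : b ⟶ K.obj Γ) {σ : Sg.Sorts} (M N : Term Sg Γ σ) :
    X.pull (lift (f ≫ K.hom (Sub.single M)) (f ≫ K.hom (Sub.single N))) (X.Eq (K.obj [σ])) =
      X.pull f (K.cls (.eq σ M N)) := by
  rw [← comp_lift, lift_hom, K.Eq_cls, ← X.pull_comp]
  simp only [Category.assoc, eqToHom_trans, eqToHom_refl, Category.comp_id]
  rw [X.pull_comp, K.pull_cls, Formula.subst_eqCtx, Sub.pair_comp_projLeft,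
    Sub.pair_comp_projRight]
  rfl

theorem generic_form (φ : Formula L Sg Γ) :
    K.generic.form φ = X.pull (eqToHom (K.ctxObj_eq Γ)) (K.cls φ) := by
  induction φ with
  | @rel Γ R args =>
    exact (X.pull_comp _ _ _).symm.trans <|
      (congrArg (fun k => X.pull k (K.cls (.rel R (Sub.ids _)))) (K.generic_terms args)).trans <|
      (X.pull_comp _ _ _).trans (congrArg (X.pull (eqToHom (K.ctxObj_eq Γ))) (K.pull_cls args _))
  | @eq Γ σ M N =>
    exact (congrArg₂ (fun k k' => X.pull (lift k k') (X.Eq (K.obj [σ]))) (K.generic_term M)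
      (K.generic_term N)).trans (K.pull_lift_Eq _ M N)
  | @conn Γ n d φ ih =>
    refine (congrArg (X.conn _ d) (funext ih)).trans ?_
    rw [← K.conn_cls]
    exact (X.conn_natural _ d _).symm
  | @quant Γ Ω σ φ ih =>
    change X.quant Ω _ (K.obj [σ]) (X.pull (ctxExt (fun σ => K.obj [σ]) σ Γ)
      (K.generic.form φ)) = _
    rw [ih, ← X.pull_comp, ctxExt_comp_eqToHom, X.pull_comp]
    -- Naturality brings the comparison of contexts outside the quantifier, leaving quantification
    -- over the one-variable context `[σ]`.
    exact (X.quant_natural Ω (eqToHom (K.ctxObj_eq Γ)) (K.obj [σ]) _).symm.trans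
      (congrArg _ (K.quant_cls Ω Γ [σ] φ))

theorem conn_tensor_cls (φ ψ : Formula L Sg Γ) :
    X.conn (K.obj Γ) L.tensor ![K.cls φ, K.cls ψ] = K.cls (φ.tensor ψ) :=
  Eq.trans (congrArg _ <| by funext i; fin_cases i <;> rfl) (K.conn_cls L.tensor ![φ, ψ])

theorem conn_e_cls : X.conn (K.obj Γ) L.e ![] = K.cls (Formula.e : Formula L Sg Γ) :=
  (congrArg _ (Subsingleton.elim _ _)).trans (K.conn_cls L.e ![])

theorem tensorList_cls : ∀ Φ : List (Formula L Sg Γ),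
    X.tensorList (K.obj Γ) (Φ.map K.cls) = K.cls (Formula.tensorList Φ)
  | [] => K.conn_e_cls
  -- The semantic fold ends with a factor `e`, which the syntactic tensor of a singleton lacks.
  | [_] => X.tensor_unit _ _
  | φ :: ψ :: Φ =>
    (congrArg (fun r => X.conn (K.obj Γ) L.tensor ![K.cls φ, r]) (tensorList_cls (ψ :: Φ))).trans
      (K.conn_tensor_cls _ _)

/-- The comparison isomorphism cancels from equations and reflects the order, so satisfaction
becomes equality or order of classes in the classifying prop-category. -/
theorem generic_satisfies_iff (hT : ∀ a, MinDerivable T a → a ∈ T) :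
    ∀ a : Assertion L Sg, K.generic.Satisfies a ↔ a ∈ T
  | .eqn (Γ := Γ) M N => by
      refine (iff_of_eq (congrArg₂ (· = ·) (K.generic_term M) (K.generic_term N))).trans <|
        (cancel_epi (eqToHom (K.ctxObj_eq Γ))).trans <| (K.hom_eq_iff _ _).trans
        ⟨fun h => h _ .zero, fun h σ v => ?_⟩
      cases v with
      | zero => exact h
      | succ v => exact nomatch v
  | .seq (Γ := Γ) Φ ψ => by
      have hΦ : Φ.map K.generic.form = (Φ.map K.cls).map (X.pull (eqToHom (K.ctxObj_eq Γ))) := by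
        rw [List.map_map]
        exact List.map_congr_left fun φ _ => K.generic_form φ
      change X.tensorList _ (Φ.map K.generic.form) ≤ K.generic.form ψ ↔ _
      rw [hΦ, generic_form]
      refine (iff_of_eq (congrArg (· ≤ _) (X.pull_tensorList _ _).symm)).trans <|
        (X.pull_eqToHom_le_iff (K.ctxObj_eq Γ)).trans ?_
      rw [tensorList_cls, K.cls_le_iff]
      exact ⟨fun h => hT _ (MinDerivable.seq_tensorList.1 (.hyp h)),
        fun h => hT _ (MinDerivable.seq_tensorList.2 (.hyp h))⟩

end Classifying

end PropLogic

theorem mainTheorem5 {L : PropLogic.FOLang.{ℓ}} (ℒ : PropLogic.Logic.{ℓ, s} L)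
    (hℒ : ℒ.Contains (PropLogic.Logic.minimal L)) : ℒ.Adequate := by
  intro Sg T hT
  -- The minimal closure of `T` lies in its `ℒ`-closure, which is `T` itself.
  have hmin : ∀ a, PropLogic.MinDerivable T a → a ∈ T := fun a ha => hT.subset (hℒ Sg T ha)
  have hTh := (PropLogic.classifying hmin).generic_satisfies_iff hmin
  exact ⟨_, PropLogic.classifying hmin, fun a ha => (hTh a).2 ha, Set.ext hTh,
    fun _ _ M => (PropLogic.classifying hmin).generic_term M,
    fun _ φ => (PropLogic.classifying hmin).generic_form φ⟩
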